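/- **Setting.** Let $L,n\ge 1$, let $\mathcal X$ be a measurable space, $[L]=\{1,\dots,L\}$, let $\mathbf g:\mathcal X\to\Delta^{L-1}$ be a measurable base predictor with values in the probability simplex, $c(x)\in\arg\max_{l}g_l(x)$ its top class (ties broken in any measurable way), and $g(x)=g_{c(x)}(x)$ its top-class probability. Let $P$ be a probability distribution on $\mathcal X\times[L]$, let $\mathcal D=((X_1,Y_1),\dots,(X_n,Y_n))\sim P^n$ be i.i.d. calibration data, and let $(X,Y)\sim P$ be an independent test point. **Binary histogram binning** with a score function $g$, data $(X_1,Y_1),\dots,(X_N,Y_N)\in\mathcal X\times\{0,1\}$, $B\geq 1$ bins and tie-breaking parameter $\delta>0$. Write $\mathrm{jit}(t,u)=(t+\delta u)/(1+\delta)$. Draw independent uniform variables $U_1,\dots,U_N,V_1,\dots,V_B$ on $[0,1]$. Let $S_i=\mathrm{jit}(g(X_i),U_i)$, let $S_{(1)}\le\dots\le S_{(N)}$ be the order statistics, $Y_{(1)},\dots,Y_{(N)}$ the labels in the same order, $S_{(0)}=0$, $S_{(N+1)}=1$, and $A_b=\lceil b(N+1)/B\rceil$ for $0\le b\le B$. Let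 $\widehat\Pi_b$ be the mean of $Y_{(m)}$ over $A_{b-1}<m<A_b$. The output is the randomized predictor which at a query $x$ draws a fresh uniform $u\in[0,1]$ and returns $$\sum_{b=1}^B \mathbf 1\{S_{(A_{b-1})}\le \mathrm{jit}(g(x),u)<S_{(A_b)}\}\ \mathrm{jit}(\widehat\Pi_b,V_b).$$ **Top-label histogram binning** with $k$ points per bin: for each $l\in[L]$ let $\mathcal D_l=\{(X_i,\mathbf 1\{Y_i=l\}):c(X_i)=l\}$, $n_l=|\mathcal D_l|$, let $h_l$ be the result of binary histogram binning of $g$ with data $\mathcal D_l$, $\lfloor n_l/k\rfloor$ bins and parameter $\delta$ (independent randomness for different $l$), and put $h(x)=h_{c(x)}(x)$. Return $(c,h)$. **Calibration notions.** In what follows conditional probabilities $\mathbb P(\,\cdot\mid\cdot\,)$ are those of the test point (together with its uniform $u$) for a fixed predictor $(c,h)$, while $\Pr$ and $\mathbb E$ also refer to the random calibration data and the randomness of the algorithm. - $(\varepsilon,\alpha)$-marginal top-label calibration: $\Pr\big(|\mathbb P(Y=c(X)\mid c(X),h(X))-h(X)|\le\varepsilon\big)\ge 1-\alpha$, where $\Pr$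 is over the calibration randomness and the test point. - $(\varepsilon,\alpha)$-conditional top-label calibration: with probability at least $1-\alpha$ over the calibration randomness, $|\mathbb P(Y=c(X)\mid c(X)=l,h(X)=r)-r|\le\varepsilon$ for all $l\in[L]$ and all values $r$ of $h$ for which the event $\{c(X)=l,h(X)=r\}$ has positive probability. - $\text{TL-ECE}(c,h)=\mathbb E_X|\mathbb P(Y=c(X)\mid c(X),h(X))-h(X)|$, for a fixed predictor $(c,h)$. **Theorem.** Let $\delta>0$, $k\ge 2$ and $\alpha\in(0,1)$. Assume $n_l\ge k$ for every $l\in[L]$, in the following sense: all probabilities and expectations over the calibration data are conditional on an event $\{(n_1,\dots,n_L)\in T\}$ of positive probability, where $T$ is any set of vectors of counts all of whose entries are at least $k$ (for instance $T$ a single vector, or $T$ the set of all such vectors). Then, for every distribution $P$, top-label histogram binning is $(\varepsilon_1,\alpha)$-marginally and $(\varepsilon_2,\alpha)$-conditionally top-label calibrated, with $$\varepsilon_1=\sqrt{\frac{\log(2/\alpha)}{2(k-1)}}+\delta,\qquad \varepsilon_2=\sqrt{\frac{\log\big(2n/(k\alpha)\big)}{2(k-1)}}+\delta .$$ Moreover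 $\Pr\big(\text{TL-ECE}(c,h)\le\varepsilon_2\big)\ge 1-\alpha$ and $\mathbb E[\text{TL-ECE}(c,h)]\le\sqrt{1/(2k)}+\delta$. -/

import Mathlib

open MeasureTheory ProbabilityTheory
open scoped unitInterval

noncomputable section

/-! ### Binary histogram binning (uniform-mass binning, with randomized tie-breaking) -/

/-- The `δ`-randomization of a number `t ∈ [0,1]` by a uniform `u ∈ [0,1]`. The result lies in
`[0,1]`, and differs from `t` by at most `δ`. -/
def jitter (δ : ℝ) (t : ℝ) (u : I) : ℝ := (t + δ * u) / (1 + δ)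

/-- The `m`-th order statistic `S_(m)` of `s` for `1 ≤ m ≤ N` (ranks start at one), with
the conventions `S_(0) = 0` and `S_(N+1) = 1`. -/
def orderStat {N : ℕ} (s : Fin N → ℝ) (m : ℕ) : ℝ :=
  if m = 0 then 0
  else if h : m - 1 < N then s (Tuple.sort s ⟨m - 1, h⟩)
  else 1

/-- The rank `A_b = ⌈b (N + 1) / B⌉` of the `b`-th bin edge; `A_0 = 0` and `A_B = N + 1`. -/
def edgeRank (N B b : ℕ) : ℕ := ⌈(b : ℝ) * ((N : ℝ) + 1) / (B : ℝ)⌉₊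

/-- The sorted positions that are strictly between the edges of bin `b` (bins are numbered
from zero; position `i : Fin N` has rank `i + 1`). -/
def binInterior (N B b : ℕ) : Finset (Fin N) :=
  {i | edgeRank N B b < (i : ℕ) + 1 ∧ (i : ℕ) + 1 < edgeRank N B (b + 1)}

/-- The mean of the labels of the points strictly inside bin `b`, where the labels `y` are ordered
as the scores `s`. -/
def binMean {N : ℕ} (s : Fin N → ℝ) (y : Fin N → Bool) (B b : ℕ) : ℝ :=
  (∑ i ∈ binInterior N B b, if y (Tuple.sort s i) then (1 : ℝ) else 0) /
    ((binInterior N B b).card : ℝ)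

/-- Binary histogram binning of the score function `g` with calibration data `D`, `B` bins and
tie-breaking parameter `δ`. The randomness of the algorithm: `U i` randomizes the score of the `i`-th
calibration point, `V b` randomizes the output of bin `b`, and the predictor that is returned
takes a query point together with the uniform variable that randomizes the score of the query. -/
def binaryHistogramBinning {X : Type*} {N : ℕ} (g : X → ℝ) (D : Fin N → X × Bool) (B : ℕ) (δ : ℝ)
    (U : Fin N → I) (V : Fin B → I) (q : X × I) : ℝ :=
  let s : Fin N → ℝ := fun i => jitter δ (g (D i).1) (U i)
  ∑ b : Fin B,
    Set.indicator
      (Set.Ico (orderStat s (edgeRank N B b)) (orderStat s (edgeRank N B (b + 1))))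
      (fun _ => jitter δ (binMean s (fun i => (D i).2) B b) (V b))
      (jitter δ (g q.1) q.2)

/-! ### Top-label histogram binning -/

/-- The indices of the calibration points with predicted class `l`. -/
def classIdx {X : Type*} {L n : ℕ} (c : X → Fin L) (D : Fin n → X × Fin L) (l : Fin L) :
    Finset (Fin n) :=
  {i | c (D i).1 = l}

/-- The number `n_l` of calibration points with predicted class `l`. -/
def classCount {X : Type*} {L n : ℕ} (c : X → Fin L) (D : Fin n → X × Fin L) (l : Fin L) : ℕ :=
  (classIdx c D l).card

/-- The position in `D` of the `j`-th calibration point with predicted class `l`. -/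
def classPos {X : Type*} {L n : ℕ} (c : X → Fin L) (D : Fin n → X × Fin L) (l : Fin L)
    (j : Fin (classCount c D l)) : Fin n :=
  (classIdx c D l).orderEmbOfFin rfl j

/-- The binary data set `D_l = {(X_i, 1{Y_i = l}) : c(X_i) = l}`. -/
def classData {X : Type*} {L n : ℕ} (c : X → Fin L) (D : Fin n → X × Fin L) (l : Fin L)
    (j : Fin (classCount c D l)) : X × Bool :=
  ((D (classPos c D l j)).1, decide ((D (classPos c D l j)).2 = l))

theorem classCount_div_le {X : Type*} {L n : ℕ} (c : X → Fin L) (D : Fin n → X × Fin L)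
    (l : Fin L) (k : ℕ) : classCount c D l / k ≤ n :=
  (Nat.div_le_self _ _).trans ((Finset.card_le_univ _).trans_eq (Fintype.card_fin n))

/-- The outcome space of calibration: the calibration data, the uniform variables that randomize
the scores of the calibration points, and those that randomize the outputs of the bins
(of every class; each class has at most `n` bins, and the unused variables are ignored). -/
abbrev CalibrationOutcome (X : Type*) (L n : ℕ) : Type _ :=
  (Fin n → X × Fin L) × (Fin n → I) × (Fin L → Fin n → I)

/-- Top-label histogram binning with `k` points per bin: the predictor `h` computed from the
base multiclass predictor `g`, with top class `c` and top-class probability `x ↦ g x (c x)`. The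
number of bins of class `l` is `⌊n_l / k⌋`. -/
def topLabelHistogramBinning {X : Type*} {L n : ℕ} (g : X → Fin L → ℝ) (c : X → Fin L) (k : ℕ)
    (δ : ℝ) (ω : CalibrationOutcome X L n) (q : X × I) : ℝ :=
  let D := ω.1
  let l := c q.1
  binaryHistogramBinning (fun x => g x (c x)) (classData c D l) (classCount c D l / k) δ
    (fun j => ω.2.1 (classPos c D l j))
    (fun b => ω.2.2 l (Fin.castLE (classCount_div_le c D l k) b)) q

/-- The law of calibration: `n` i.i.d. points from `P`, and independent uniform variables. -/
def calibrationLaw {X : Type*} [MeasurableSpace X] {L : ℕ} (P : Measure (X × Fin L)) (n : ℕ) :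
    Measure (CalibrationOutcome X L n) :=
  (Measure.pi fun _ : Fin n => P).prod
    ((Measure.pi fun _ : Fin n => (volume : Measure I)).prod
      (Measure.pi fun _ : Fin L => Measure.pi fun _ : Fin n => (volume : Measure I)))

/-! ### Top-label calibration

A top-label predictor is a pair `(c, h)`; the confidence `h` may be randomized, so that it takes
a point `x` together with a uniform variable. -/

/-- The law of a test point `((X, Y), u)`: `(X, Y) ∼ P`, and `u` is independent and uniform. -/
def testLaw {X : Type*} [MeasurableSpace X] {L : ℕ} (P : Measure (X × Fin L)) :
    Measure ((X × Fin L) × I) :=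
  P.prod volume

/-- The event `Y = c(X)`. -/
def correctSet {X : Type*} {L : ℕ} (c : X → Fin L) : Set ((X × Fin L) × I) :=
  {z | z.1.2 = c z.1.1}

/-- The reported confidence `h(X)`. -/
def confidence {X : Type*} {L : ℕ} (h : X × I → ℝ) (z : (X × Fin L) × I) : ℝ := h (z.1.1, z.2)

/-- The event `c(X) = l, h(X) = r`. -/
def levelSet {X : Type*} {L : ℕ} (c : X → Fin L) (h : X × I → ℝ) (l : Fin L) (r : ℝ) :
    Set ((X × Fin L) × I) :=
  {z | c z.1.1 = l ∧ confidence h z = r}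

/-- The conditional probability `P(Y = c(X) | c(X), h(X))` of a test point, for a fixed predictor
`(c, h)`. -/
def condCorrect {X : Type*} [MeasurableSpace X] {L : ℕ} (P : Measure (X × Fin L)) (c : X → Fin L)
    (h : X × I → ℝ) : (X × Fin L) × I → ℝ :=
  (testLaw P)[(correctSet c).indicator (fun _ => (1 : ℝ)) |
    MeasurableSpace.comap (fun z : (X × Fin L) × I => (c z.1.1, confidence h z)) inferInstance]

/-- The top-label expected calibration error `E |P(Y = c(X) | c(X), h(X)) - h(X)|`. -/
def tlECE {X : Type*} [MeasurableSpace X] {L : ℕ} (P : Measure (X × Fin L)) (c : X → Fin L)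
    (h : X × I → ℝ) : ℝ :=
  ∫ z, |condCorrect P c h z - confidence h z| ∂(testLaw P)

/-- `(ε, α)`-marginal top-label calibration under the distribution `P`, for a random predictor
`(c, h ω)` with `ω ∼ ν`:
`Pr (|P(Y = c(X) | c(X), h(X)) - h(X)| ≤ ε) ≥ 1 - α`, where the outer probability is over `ω` and the
independent test point (written as an iterated integral, which does not depend on the chosen
versions of the conditional probability). -/
def MarginallyTopLabelCalibrated {X Ω : Type*} [MeasurableSpace X] [MeasurableSpace Ω] {L : ℕ}
    (ν : Measure Ω) (P : Measure (X × Fin L)) (c : X → Fin L) (h : Ω → X × I → ℝ)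
    (ε α : ℝ) : Prop :=
  ENNReal.ofReal (1 - α) ≤
    ∫⁻ ω, testLaw P {z | |condCorrect P c (h ω) z - confidence (h ω) z| ≤ ε} ∂ν

/-- `(ε, α)`-conditional top-label calibration under the distribution `P`, for a random predictor
`(c, h ω)` with `ω ∼ ν`: with probability at least `1 - α` over `ω`,
`|P(Y = c(X) | c(X) = l, h(X) = r) - r| ≤ ε` for all `l` and all `r` (where the conditional
probability makes sense, that is, `c(X) = l, h(X) = r` has positive probability; such an `r` is in
the range of `h`). It is stated as a bound by `α` on the (outer) probability of failure. -/
def ConditionallyTopLabelCalibrated {X Ω : Type*} [MeasurableSpace X] [MeasurableSpace Ω] {L : ℕ}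
    (ν : Measure Ω) (P : Measure (X × Fin L)) (c : X → Fin L) (h : Ω → X × I → ℝ)
    (ε α : ℝ) : Prop :=
  ν {ω | ¬ ∀ (l : Fin L) (r : ℝ), testLaw P (levelSet c (h ω) l r) ≠ 0 →
      |((testLaw P)[|levelSet c (h ω) l r]).real (correctSet c) - r| ≤ ε} ≤ ENNReal.ofReal α

end

/-! ### Products of conditional distributions -/

/-! Attach to each calibration point its score noise: the triples `z i = (X_i, Y_i, U_i)` are i.i.d.
with law `Q = testLaw P`. Let `t` be the event of a correct label, `J` the indices of class `l`, and
consider a bin with edge ranks `p < q`. Almost surely all scores are distinct. The heart of the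
proof is that the `q - p - 1` points strictly inside the bin are conditionally i.i.d. with law `Q`
restricted to that bin, and this is shown without any density of order statistics. If `M` is the
random set of interior indices, the bin is exactly the set of queries of class `l` with `p` points
of `J \ M` below them (`countBelow_sdiff_rankInterior_eq_iff`), and a candidate set `M` of the right
size is the interior if and only if all its points satisfy this same condition
(`eq_rankInterior_iff`). So, with the coordinates outside `M` frozen, the event "`M` is the
interior" says that every `z i`, `i ∈ M`, lies in a fixed region `W`, which is the bin itself;
restricting a product measure to a power of `W` gives a product of copies of `Q[|W]`. Summing over
`M` and over class assignments yields `lintegral_countBin_loss_le` and `lintegral_binLoss_le`.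

Hence the label mean of a bin estimates `Q[|W] t` from at least `k - 1` independent points
(`edgeRank_add_le`), and any bound for i.i.d. samples transfers. Two losses are used: the indicator
of a deviation above `ε` (Hoeffding) and the absolute deviation (variance bound). Two weights are
used. Weighting a bin by its mass, with total at most `1`, gives the marginal statement and the
expected error; weighting each bin by `1`, with at most `n / k` bins, gives a union bound and so the
conditional statement.

To pass from bins to values of `h`, the output noise makes the values of different bins of one class
almost surely distinct: label means are rational, and differences of independent uniforms avoid a
countable set. Conditioning on `c(X)` and `h(X)` is then conditioning on the bin
(`IsBinnedPredictor`, `ae_isBinnedPredictor`). The output noise moves each value by at most `δ`,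
which is the extra term in every bound. Conditioning on the class counts is harmless, because the
main estimate holds for each class assignment separately. -/

/-- The fraction of the points `z i`, `i ∈ M`, that lie in `t`. -/
noncomputable def hitMean {Z ι : Type*} (t : Set Z) (M : Finset ι) (z : ι → Z) : ℝ :=
  (∑ i ∈ M, t.indicator (fun _ => (1 : ℝ)) (z i)) / (M.card : ℝ)

theorem indicator_one_mem_Icc {α : Type*} (t : Set α) (a : α) :
    t.indicator (fun _ => (1 : ℝ)) a ∈ Set.Icc (0 : ℝ) 1 := by
  by_cases h : a ∈ t <;> simp [h]

theorem hitMean_mem_Icc {Z ι : Type*} (t : Set Z) (M : Finset ι) (z : ι → Z) :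
    hitMean t M z ∈ Set.Icc (0 : ℝ) 1 := by
  constructor
  · exact div_nonneg (Finset.sum_nonneg fun i _ => (indicator_one_mem_Icc t _).1) (by positivity)
  · refine div_le_one_of_le₀ ?_ (by positivity)
    simpa using Finset.sum_le_card_nsmul M _ (1 : ℝ) fun i _ => (indicator_one_mem_Icc t (z i)).2

theorem exists_hitMean_eq_ratCast {Z ι : Type*} (t : Set Z) (M : Finset ι) (z : ι → Z) :
    ∃ q : ℚ, hitMean t M z = q := by
  classical
  refine ⟨(∑ i ∈ M, if z i ∈ t then 1 else 0) / (M.card : ℚ), ?_⟩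
  simp [hitMean, Set.indicator_apply]

theorem measurable_hitMean {Z ι : Type*} [MeasurableSpace Z] {t : Set Z} (ht : MeasurableSet t)
    (M : Finset ι) : Measurable (hitMean t M) := by
  unfold hitMean
  refine Measurable.div_const (Finset.measurable_sum _ fun i _ => ?_) _
  exact (measurable_const.indicator ht).comp (measurable_pi_apply i)

/-- Both sides agree on boxes, where `Q.restrict W = Q W • Q[|W]` in each factor. This is the source
of conditional independence; the power of `Q W` later appears on both sides of an inequality and
plays no role. -/
theorem pi_restrict_eq_smul_pi_cond {Z ι : Type*} [MeasurableSpace Z] [Fintype ι]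
    (Q : Measure Z) [IsProbabilityMeasure Q] {W : Set Z} (hW : MeasurableSet W) (h0 : Q W ≠ 0) :
    (Measure.pi fun _ : ι => Q).restrict {y | ∀ i, y i ∈ W} =
      Q W ^ Fintype.card ι • Measure.pi fun _ : ι => Q[|W] := by
  have : IsProbabilityMeasure (Q[|W]) := cond_isProbabilityMeasure h0
  have hset : {y : ι → Z | ∀ i, y i ∈ W} = Set.univ.pi fun _ => W := by ext; simp
  rw [hset, Measure.restrict_pi_pi]
  refine Measure.pi_eq fun s hs => ?_
  rw [Measure.smul_apply, Measure.pi_pi, smul_eq_mul]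
  have : ∀ i, Q.restrict W (s i) = Q W * Q[|W] (s i) := fun i => by
    rw [cond_apply hW, Measure.restrict_apply (hs i), ← mul_assoc,
      ENNReal.mul_inv_cancel h0 (measure_ne_top _ _), one_mul, Set.inter_comm]
  simp only [this, Finset.prod_mul_distrib, Finset.prod_const, Finset.card_univ]

/-- A bound on a loss of the hit frequency of independent points with law `Q[|W]`. -/
def CondLossBound {Z : Type*} [MeasurableSpace Z] (Q : Measure Z) (t : Set Z) (ψ : ℝ → ℝ → ENNReal)
    (m : ℕ) (C : ENNReal) : Prop :=
  ∀ (ι : Type) [Fintype ι] (W : Set Z), Fintype.card ι = m → MeasurableSet W → Q W ≠ 0 →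
    ∫⁻ y, ψ (hitMean t Finset.univ y) (Q[|W].real t) ∂(Measure.pi fun _ : ι => Q[|W]) ≤ C

theorem hitMean_updateFinset {Z ι : Type*} [DecidableEq ι] (t : Set Z) (M : Finset ι) (x : ι → Z)
    (y : M → Z) : hitMean t M (Function.updateFinset x M y) = hitMean t Finset.univ y := by
  unfold hitMean
  congr 1
  · rw [← Finset.sum_coe_sort]
    refine Finset.sum_congr rfl fun i _ => ?_
    simp [Function.updateFinset]
  · simp

/-- If, given the other coordinates, the coordinates in `M` are only required to lie in a region
determined by these others, then conditionally they are independent with law `Q[|W]`. -/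
theorem lintegral_mul_loss_le {Z : Type*} [MeasurableSpace Z] (Q : Measure Z)
    [IsProbabilityMeasure Q] {n : ℕ} {M : Finset (Fin n)} (hM : M.Nonempty) {t : Set Z}
    (ht : MeasurableSet t) {W : (Fin n → Z) → Set Z}
    (hWm : MeasurableSet {x : (Fin n → Z) × Z | x.2 ∈ W x.1})
    (hW : ∀ x y, W (Function.updateFinset x M y) = W x) {w : (Fin n → Z) → ENNReal}
    (hwm : Measurable w) (hw : ∀ x y, w (Function.updateFinset x M y) = w x)
    {ψ : ℝ → ℝ → ENNReal} (hψ : Measurable (Function.uncurry ψ)) {C : ENNReal}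
    (hC : CondLossBound Q t ψ M.card C) :
    ∫⁻ z in {z | ∀ i ∈ M, z i ∈ W z}, w z * ψ (hitMean t M z) (Q[|W z].real t)
        ∂(Measure.pi fun _ => Q) ≤
      C * ∫⁻ z in {z | ∀ i ∈ M, z i ∈ W z}, w z ∂(Measure.pi fun _ => Q) := by
  have hWz : ∀ z, MeasurableSet (W z) := fun z => measurable_prodMk_left hWm
  have hE : MeasurableSet {z : Fin n → Z | ∀ i ∈ M, z i ∈ W z} := by
    simp only [Set.ofPred_forall]
    refine MeasurableSet.iInter fun i => MeasurableSet.iInter fun _ => ?_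
    exact (measurable_id.prodMk (measurable_pi_apply i)) hWm
  have hQW : Measurable fun z => Q (W z) := measurable_measure_prodMk_left hWm
  have hQWt : Measurable fun z => Q (W z ∩ t) :=
    measurable_measure_prodMk_left (hWm.inter (measurable_snd ht))
  have hπ : Measurable fun z => Q[|W z].real t := by
    simp only [Measure.real, fun z => cond_apply (hWz z) Q t]
    exact (hQW.inv.mul hQWt).ennreal_toReal
  have hf : Measurable fun z => w z * ψ (hitMean t M z) (Q[|W z].real t) :=
    hwm.mul (hψ.comp ((measurable_hitMean ht M).prodMk hπ))
  rw [← lintegral_indicator hE, ← lintegral_indicator hE, ← lintegral_const_mul _ (hwm.indicator hE)]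
  -- It suffices to compare the integrals over the coordinates in `M`, with the others frozen at
  -- `x`; there the region, the weight and the target probability are constants.
  refine lintegral_le_of_lmarginal_le M (hf.indicator hE)
    ((hwm.indicator hE).const_mul C) fun x => ?_
  have hmem : ∀ y : M → Z, Function.updateFinset x M y ∈ {z : Fin n → Z | ∀ i ∈ M, z i ∈ W z} ↔
      y ∈ {y : M → Z | ∀ i, y i ∈ W x} := by
    intro y
    simp only [Set.mem_ofPred_eq, hW]
    constructor
    · intro h i
      simpa [Function.updateFinset] using h i i.2
    · intro h i hi
      simpa [Function.updateFinset, hi] using h ⟨i, hi⟩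
  have hE' : MeasurableSet {y : M → Z | ∀ i, y i ∈ W x} := by
    simp only [Set.ofPred_forall]
    exact MeasurableSet.iInter fun i => measurable_pi_apply i (hWz x)
  have h1 : ∀ F : (Fin n → Z) → ENNReal, ∀ G : (M → Z) → ENNReal,
      (∀ y, F (Function.updateFinset x M y) = G y) →
      (∫⋯∫⁻_M, {z : Fin n → Z | ∀ i ∈ M, z i ∈ W z}.indicator F ∂fun _ => Q) x =
      ∫⁻ y in {y : M → Z | ∀ i, y i ∈ W x}, G y ∂(Measure.pi fun _ : M => Q) := by
    intro F G hFG
    rw [← lintegral_indicator hE']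
    refine lintegral_congr fun y => ?_
    by_cases hy : y ∈ {y : M → Z | ∀ i, y i ∈ W x}
    · rw [Set.indicator_of_mem hy, Set.indicator_of_mem ((hmem y).2 hy), hFG]
    · rw [Set.indicator_of_notMem hy, Set.indicator_of_notMem (mt (hmem y).1 hy)]
  have h2 : (fun z => C * {z : Fin n → Z | ∀ i ∈ M, z i ∈ W z}.indicator w z) =
      {z : Fin n → Z | ∀ i ∈ M, z i ∈ W z}.indicator (fun z => C * w z) := by
    ext z
    rw [Set.indicator_const_mul]
  rw [h2, h1 _ (fun y => w x * ψ (hitMean t Finset.univ y) (Q[|W x].real t))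
    (fun y => by rw [hw, hW, hitMean_updateFinset]), h1 _ (fun _ => C * w x) (fun y => by rw [hw])]
  -- A null region admits no conditional law, but then, `M` being nonempty, the event itself is null
  -- and both sides vanish.
  by_cases h0 : Q (W x) = 0
  · obtain ⟨i, hi⟩ := hM
    have : (Measure.pi fun _ : M => Q) {y : M → Z | ∀ i, y i ∈ W x} = 0 := by
      have hset : {y : M → Z | ∀ i, y i ∈ W x} = Set.univ.pi fun _ => W x := by ext; simp
      rw [hset, Measure.pi_pi]
      exact Finset.prod_eq_zero (Finset.mem_univ ⟨i, hi⟩) h0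
    rw [Measure.restrict_eq_zero.2 this]
    simp
  · have : IsProbabilityMeasure (Q[|W x]) := cond_isProbabilityMeasure h0
    rw [pi_restrict_eq_smul_pi_cond Q (hWz x) h0, lintegral_smul_measure, lintegral_smul_measure,
      lintegral_const, measure_univ, mul_one, smul_eq_mul, smul_eq_mul, mul_comm C]
    gcongr
    rw [lintegral_const_mul]
    · gcongr
      exact hC M (W x) (by simp) (hWz x) h0
    · exact hψ.comp ((measurable_hitMean ht _).prodMk measurable_const)

/-! ### Concentration of the hit frequency -/

section Concentration

variable {Z : Type*} [MeasurableSpace Z] {ι : Type*} [Fintype ι] (Q : Measure Z)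
  [IsProbabilityMeasure Q] {t : Set Z}

theorem integral_indicator_eval (ht : MeasurableSet t) (i : ι) :
    ∫ y, t.indicator (fun _ => (1 : ℝ)) (y i) ∂(Measure.pi fun _ : ι => Q) = Q.real t := by
  rw [integral_comp_eval (μ := fun _ : ι => Q) (i := i) (f := t.indicator fun _ => (1 : ℝ))
    (measurable_const.indicator ht).aestronglyMeasurable, integral_indicator_const _ ht]
  simp

theorem iIndepFun_indicator_eval (ht : MeasurableSet t) :
    iIndepFun (fun (i : ι) (y : ι → Z) => t.indicator (fun _ => (1 : ℝ)) (y i))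
      (Measure.pi fun _ : ι => Q) :=
  iIndepFun_pi (X := fun (_ : ι) z => t.indicator (fun _ => (1 : ℝ)) z)
    fun _ => (measurable_const.indicator ht).aemeasurable

/-- Hoeffding: a centred indicator is sub-Gaussian with variance proxy `1/4`, so a sum of `m` of
them has proxy `m/4`, and the threshold `m ε` gives the exponent `-(m ε)² / (2 · m/4) = -2 m ε²`. -/
theorem measureReal_le_hitMean_sub (ht : MeasurableSet t) [Nonempty ι] {ε : ℝ} (hε : 0 ≤ ε) :
    (Measure.pi fun _ : ι => Q).real {y | ε ≤ hitMean t Finset.univ y - Q.real t} ≤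
        Real.exp (-(2 * Fintype.card ι * ε ^ 2)) ∧
      (Measure.pi fun _ : ι => Q).real {y | ε ≤ Q.real t - hitMean t Finset.univ y} ≤
        Real.exp (-(2 * Fintype.card ι * ε ^ 2)) := by
  have hm : (0 : ℝ) < Fintype.card ι := by exact_mod_cast Fintype.card_pos
  have hsub : ∀ i : ι, HasSubgaussianMGF
      (fun y : ι → Z => t.indicator (fun _ => (1 : ℝ)) (y i) - Q.real t) ((‖(1 : ℝ) - 0‖₊ / 2) ^ 2)
      (Measure.pi fun _ : ι => Q) := fun i => by
    have h := hasSubgaussianMGF_of_mem_Icc (μ := Measure.pi fun _ : ι => Q)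
      (X := fun y : ι → Z => t.indicator (fun _ => (1 : ℝ)) (y i)) (a := 0) (b := 1)
      ((measurable_const.indicator ht).comp (measurable_pi_apply i)).aemeasurable
      (ae_of_all _ fun y => indicator_one_mem_Icc t (y i))
    rwa [integral_indicator_eval Q ht i] at h
  have hind : iIndepFun (fun (i : ι) (y : ι → Z) => t.indicator (fun _ => (1 : ℝ)) (y i) - Q.real t)
      (Measure.pi fun _ : ι => Q) :=
    (iIndepFun_indicator_eval Q ht).comp (fun _ x => x - Q.real t) fun _ => by fun_prop
  have hind' : iIndepFun
      (fun (i : ι) (y : ι → Z) => -(t.indicator (fun _ => (1 : ℝ)) (y i) - Q.real t))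
      (Measure.pi fun _ : ι => Q) :=
    (iIndepFun_indicator_eval Q ht).comp (fun _ x => -(x - Q.real t)) fun _ => by fun_prop
  have hε' : 0 ≤ Fintype.card ι * ε := by positivity
  have e : -(Fintype.card ι * ε) ^ 2 /
      (2 * ((∑ _i : ι, (‖(1 : ℝ) - 0‖₊ / 2) ^ 2 : NNReal) : ℝ)) =
      -(2 * Fintype.card ι * ε ^ 2) := by
    simp
    field_simp
  have hsum : ∀ y : ι → Z, ∑ i, (t.indicator (fun _ => (1 : ℝ)) (y i) - Q.real t) =
      Fintype.card ι * (hitMean t Finset.univ y - Q.real t) := fun y => by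
    simp only [hitMean, Finset.sum_sub_distrib, Finset.sum_const, Finset.card_univ, nsmul_eq_mul]
    field_simp
  have hneg : ∀ y : ι → Z, ∑ i, -(t.indicator (fun _ => (1 : ℝ)) (y i) - Q.real t) =
      Fintype.card ι * (Q.real t - hitMean t Finset.univ y) := fun y => by
    rw [Finset.sum_neg_distrib, hsum]; ring
  constructor
  · have h := HasSubgaussianMGF.measure_sum_ge_le_of_iIndepFun hind (s := Finset.univ)
      (fun i _ => hsub i) hε'
    rw [e] at h
    simpa only [hsum, mul_le_mul_iff_right₀ hm] using h
  · have h := HasSubgaussianMGF.measure_sum_ge_le_of_iIndepFun hind' (s := Finset.univ)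
      (fun i _ => (hsub i).neg) hε'
    rw [e] at h
    simpa only [hneg, mul_le_mul_iff_right₀ hm] using h

/-- A variable with values in `[0,1]` has variance at most `1/4`, so the mean of `m` independent
ones has variance at most `1/(4m)`, and the first absolute moment is at most the standard deviation.
-/
theorem integral_abs_hitMean_sub_le (ht : MeasurableSet t) [Nonempty ι] :
    ∫ y, |Q.real t - hitMean t Finset.univ y| ∂(Measure.pi fun _ : ι => Q) ≤
      1 / (2 * √(Fintype.card ι)) := by
  have hm : (0 : ℝ) < Fintype.card ι := by exact_mod_cast Fintype.card_pos
  set μ := Measure.pi fun _ : ι => Q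
  set X : ι → (ι → Z) → ℝ := fun i y => t.indicator (fun _ => (1 : ℝ)) (y i)
  have hXm : ∀ i, Measurable (X i) := fun i =>
    (measurable_const.indicator ht).comp (measurable_pi_apply i)
  have hX2 : ∀ i, MemLp (X i) 2 μ := fun i =>
    MemLp.of_bound (hXm i).aestronglyMeasurable 1 (ae_of_all _ fun y => by
      have := indicator_one_mem_Icc t (y i)
      rw [Real.norm_eq_abs, abs_of_nonneg this.1]; exact this.2)
  have hvar : Var[∑ i, X i; μ] ≤ Fintype.card ι / 4 := by
    rw [IndepFun.variance_sum (fun i _ => hX2 i) fun i _ j _ hij =>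
      (iIndepFun_indicator_eval Q ht).indepFun hij]
    calc ∑ i, Var[X i; μ] ≤ ∑ _i : ι, ((1 - 0) / 2 : ℝ) ^ 2 := Finset.sum_le_sum fun i _ =>
          variance_le_sq_of_bounded (ae_of_all _ fun y => indicator_one_mem_Icc t (y i))
            (hXm i).aemeasurable
      _ = _ := by simp; ring
  have hS2 : MemLp (∑ i, X i) 2 μ := memLp_finsetSum' _ fun i _ => hX2 i
  have hmean : μ[∑ i, X i] = Fintype.card ι * Q.real t := by
    simp only [Finset.sum_apply]
    rw [integral_finsetSum _ fun i _ => (hX2 i).integrable (by norm_num)]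
    simp [X, μ, integral_indicator_eval Q ht]
  have hF : ∀ y, Q.real t - hitMean t Finset.univ y =
      -((∑ i, X i) y - μ[∑ i, X i]) / Fintype.card ι := fun y => by
    rw [hmean]
    simp only [hitMean, Finset.sum_apply, Finset.card_univ, X]
    field_simp
    ring
  set F : (ι → Z) → ℝ := fun y => Q.real t - hitMean t Finset.univ y
  have hFeq : F = fun y => -((∑ i, X i) y - μ[∑ i, X i]) / Fintype.card ι := funext hF
  have hF2 : MemLp F 2 μ := by
    rw [hFeq]
    simp only [div_eq_mul_inv]
    exact ((hS2.sub (memLp_const _)).neg).mul_const _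
  have hsq : ∫ y, F y ^ 2 ∂μ ≤ 1 / (4 * Fintype.card ι) := by
    have : ∫ y, F y ^ 2 ∂μ = Var[∑ i, X i; μ] / (Fintype.card ι) ^ 2 := by
      rw [variance_eq_integral hS2.aemeasurable, hFeq, ← integral_div]
      congr 1 with y
      ring
    rw [this, div_le_div_iff₀ (by positivity) (by positivity)]
    nlinarith
  -- Cauchy–Schwarz, read off from the nonnegativity of the variance of `|F|`.
  have hcs : (∫ y, |F y| ∂μ) ^ 2 ≤ ∫ y, F y ^ 2 ∂μ := by
    have h := variance_nonneg (fun y => |F y|) μ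
    rw [variance_eq_sub (X := fun y => |F y|) hF2.abs] at h
    simpa using h
  refine le_of_abs_le (abs_le_of_sq_le_sq (hcs.trans (hsq.trans_eq ?_)) (by positivity))
  rw [div_pow, mul_pow, Real.sq_sqrt hm.le]
  norm_num

end Concentration

theorem condLossBound_hoeffding {Z : Type*} [MeasurableSpace Z] (Q : Measure Z)
    [IsProbabilityMeasure Q] {t : Set Z} (ht : MeasurableSet t) {ε : ℝ} (hε : 0 ≤ ε) {k m : ℕ}
    (hk : 2 ≤ k) (hm : k - 1 ≤ m) :
    CondLossBound Q t (fun a p => if ε < |p - a| then 1 else 0) m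
      (ENNReal.ofReal (2 * Real.exp (-(2 * ((k : ℝ) - 1) * ε ^ 2)))) := by
  intro ι _ W hι hW h0
  have : IsProbabilityMeasure (Q[|W]) := cond_isProbabilityMeasure h0
  have : Nonempty ι := Fintype.card_pos_iff.1 (by omega)
  set μ := Measure.pi fun _ : ι => Q[|W]
  have hmeas := measurable_hitMean ht (Finset.univ : Finset ι)
  have hset : MeasurableSet {y : ι → Z | ε < |Q[|W].real t - hitMean t Finset.univ y|} :=
    measurableSet_lt measurable_const (by fun_prop)
  have h1 := measureReal_le_hitMean_sub (ι := ι) (Q[|W]) ht hε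
  calc _ = μ {y : ι → Z | ε < |Q[|W].real t - hitMean t Finset.univ y|} := by
        rw [← lintegral_indicator_one hset]; rfl
    _ ≤ ENNReal.ofReal (2 * Real.exp (-(2 * Fintype.card ι * ε ^ 2))) := by
        rw [← ofReal_measureReal]
        refine ENNReal.ofReal_le_ofReal ?_
        calc _ ≤ μ.real ({y : ι → Z | ε ≤ hitMean t Finset.univ y - Q[|W].real t} ∪
                {y : ι → Z | ε ≤ Q[|W].real t - hitMean t Finset.univ y}) := by
              refine measureReal_mono fun y hy => ?_
              have hy : ε < |Q[|W].real t - hitMean t Finset.univ y| := hy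
              rcases lt_abs.1 hy with h | h
              · exact Or.inr h.le
              · exact Or.inl (by rw [neg_sub] at h; exact h.le)
          _ ≤ _ := (measureReal_union_le _ _).trans (by rw [two_mul]; exact add_le_add h1.1 h1.2)
    _ ≤ _ := by
        refine ENNReal.ofReal_le_ofReal ?_
        have : (k : ℝ) - 1 ≤ Fintype.card ι := by
          rw [hι]
          have : k ≤ m + 1 := by omega
          rw [sub_le_iff_le_add]; exact_mod_cast this
        gcongr

theorem condLossBound_abs {Z : Type*} [MeasurableSpace Z] (Q : Measure Z)
    [IsProbabilityMeasure Q] {t : Set Z} (ht : MeasurableSet t) {k m : ℕ}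
    (hk : 2 ≤ k) (hm : k - 1 ≤ m) :
    CondLossBound Q t (fun a p => ENNReal.ofReal |p - a|) m
      (ENNReal.ofReal √(1 / (2 * (k : ℝ)))) := by
  intro ι _ W hι hW h0
  have : IsProbabilityMeasure (Q[|W]) := cond_isProbabilityMeasure h0
  have : Nonempty ι := Fintype.card_pos_iff.1 (by omega)
  have hmeas := measurable_hitMean ht (Finset.univ : Finset ι)
  rw [← ofReal_integral_eq_lintegral_ofReal]
  · refine ENNReal.ofReal_le_ofReal ((integral_abs_hitMean_sub_le (Q[|W]) ht).trans ?_)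
    refine Real.le_sqrt_of_sq_le ?_
    rw [div_pow, mul_pow, Real.sq_sqrt (by positivity), one_pow]
    have hk' : (2 : ℝ) ≤ k := by exact_mod_cast hk
    have : (k : ℝ) ≤ Fintype.card ι + 1 := by
      rw [hι]
      have : k ≤ m + 1 := by omega
      exact_mod_cast this
    -- With `m ≥ k - 1` points, `4 m ≥ 4 (k - 1) ≥ 2 k`, the last step because `k ≥ 2`; this turns
    -- `1 / (2 √m)` into `√(1 / (2k))`.
    exact one_div_le_one_div_of_le (by positivity) (by linarith)
  · refine Integrable.of_bound (C := 1) (by fun_prop) (ae_of_all _ fun y => ?_)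
    have h1 := hitMean_mem_Icc t Finset.univ y
    have h2 : Q[|W].real t ≤ 1 := measureReal_le_one
    have h3 : 0 ≤ Q[|W].real t := measureReal_nonneg
    rw [Real.norm_eq_abs, abs_abs, abs_le]
    constructor <;> linarith [h1.1, h1.2]
  · exact ae_of_all _ fun y => abs_nonneg _

/-! ### Ranks and bins -/

section Ranks

variable {ι : Type*}

open scoped Classical in
/-- The number of indices in `J` with score below `x`. -/
noncomputable def countBelow (J : Finset ι) (s : ι → ℝ) (x : ℝ) : ℕ := (J.filter (s · < x)).card

/-- The indices in `J` whose rank (counted from zero) is at least `p` and less than `q - 1`. -/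
noncomputable def rankInterior (J : Finset ι) (s : ι → ℝ) (p q : ℕ) : Finset ι :=
  J.filter fun i => p ≤ countBelow J s (s i) ∧ countBelow J s (s i) + 1 < q

variable {J : Finset ι} {s : ι → ℝ}

theorem countBelow_le_card (J : Finset ι) (s : ι → ℝ) (x : ℝ) : countBelow J s x ≤ J.card :=
  Finset.card_filter_le _ _

theorem countBelow_mono (J : Finset ι) (s : ι → ℝ) : Monotone (countBelow J s) := by
  intro x y hxy
  refine Finset.card_le_card fun i hi => ?_
  simp only [Finset.mem_filter] at hi ⊢
  exact ⟨hi.1, hi.2.trans_le hxy⟩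

theorem lt_iff_countBelow_lt {i : ι} (hi : i ∈ J) {x : ℝ} :
    s i < x ↔ countBelow J s (s i) < countBelow J s x := by
  refine ⟨fun h => ?_, fun h => lt_of_not_ge fun h' => h.not_ge (countBelow_mono J s h')⟩
  refine Finset.card_lt_card (Finset.ssubset_iff_of_subset ?_ |>.2 ⟨i, ?_, ?_⟩)
  · intro j hj
    simp only [Finset.mem_filter] at hj ⊢
    exact ⟨hj.1, hj.2.trans h⟩
  · simp [hi, h]
  · simp

/-- Without ties the rank map is injective from `J` into `{0, …, |J| - 1}`, hence a bijection.
Counting points by a condition on their ranks thereby becomes counting integers. -/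
theorem image_countBelow (hs : Function.Injective s) :
    J.image (fun i => countBelow J s (s i)) = Finset.range J.card ∧
      Set.InjOn (fun i => countBelow J s (s i)) J := by
  have hinj : Set.InjOn (fun i => countBelow J s (s i)) J := by
    intro i hi j hj hij
    by_contra hne
    rcases lt_or_gt_of_ne (hs.ne hne) with h | h
    · exact ((lt_iff_countBelow_lt hi).1 h).ne hij
    · exact ((lt_iff_countBelow_lt hj).1 h).ne' hij
  refine ⟨Finset.eq_of_subset_of_card_le ?_ ?_, hinj⟩
  · intro r hr
    obtain ⟨i, hi, rfl⟩ := Finset.mem_image.1 hr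
    refine Finset.mem_range.2 ?_
    refine Finset.card_lt_card (Finset.ssubset_iff_of_subset (Finset.filter_subset _ _) |>.2
      ⟨i, hi, by simp⟩)
  · rw [Finset.card_range, Finset.card_image_of_injOn hinj]

theorem card_filter_countBelow (hs : Function.Injective s) (f : ℕ → Prop) [DecidablePred f] :
    (J.filter fun i => f (countBelow J s (s i))).card =
      ((Finset.range J.card).filter f).card := by
  rw [← (image_countBelow (J := J) hs).1, Finset.filter_image, Finset.card_image_of_injOn]
  exact (image_countBelow (J := J) hs).2.mono fun i hi => (Finset.mem_filter.1 hi).1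

theorem card_rankInterior (hs : Function.Injective s) {p q : ℕ} (hq : q ≤ J.card + 1) :
    (rankInterior J s p q).card = q - p - 1 := by
  rw [rankInterior, card_filter_countBelow hs fun r => p ≤ r ∧ r + 1 < q]
  have : (Finset.range J.card).filter (fun r => p ≤ r ∧ r + 1 < q) = Finset.Ico p (q - 1) := by
    ext r
    simp only [Finset.mem_filter, Finset.mem_range, Finset.mem_Ico]
    omega
  rw [this, Nat.card_Ico]
  omega

theorem rankInterior_subset (J : Finset ι) (s : ι → ℝ) (p q : ℕ) : rankInterior J s p q ⊆ J :=
  Finset.filter_subset _ _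

/-- Removing the interior leaves the ranks below `p` and those from `q - 1` on. If `c` points of `J`
are below `x`, then `min c p + (c - (q - 1))` of the remaining ones are, with truncated subtraction,
and this equals `p` exactly for `p ≤ c < q`. So the bin can be recognised from the points outside
its interior alone. -/
theorem countBelow_sdiff_rankInterior_eq_iff [DecidableEq ι] (hs : Function.Injective s) {p q : ℕ}
    (hpq : p < q) (x : ℝ) :
    countBelow (J \ rankInterior J s p q) s x = p ↔
      p ≤ countBelow J s x ∧ countBelow J s x < q := by
  have h1 : countBelow (J \ rankInterior J s p q) s x =
      (J.filter fun i => countBelow J s (s i) < countBelow J s x ∧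
        ¬ (p ≤ countBelow J s (s i) ∧ countBelow J s (s i) + 1 < q)).card := by
    rw [countBelow]
    congr 1
    ext i
    simp only [rankInterior, Finset.mem_filter, Finset.mem_sdiff]
    constructor
    · rintro ⟨⟨hi, h⟩, hx⟩
      exact ⟨hi, (lt_iff_countBelow_lt hi).1 hx, fun h' => h ⟨hi, h'⟩⟩
    · rintro ⟨hi, hx, h⟩
      exact ⟨⟨hi, fun h' => h h'.2⟩, (lt_iff_countBelow_lt hi).2 hx⟩
  have hc := countBelow_le_card J s x
  generalize countBelow J s x = c at h1 hc ⊢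
  rw [h1, card_filter_countBelow hs fun r => r < c ∧ ¬ (p ≤ r ∧ r + 1 < q)]
  have h2 : (Finset.range J.card).filter (fun r => r < c ∧ ¬ (p ≤ r ∧ r + 1 < q)) =
      Finset.range (min c p) ∪ Finset.Ico (q - 1) c := by
    ext r
    simp only [Finset.mem_filter, Finset.mem_range, Finset.mem_Ico, Finset.mem_union]
    omega
  rw [h2, Finset.card_union_of_disjoint, Finset.card_range, Nat.card_Ico]
  · omega
  · refine Finset.disjoint_left.2 fun r => ?_
    simp only [Finset.mem_range, Finset.mem_Ico]
    omega

theorem countBelow_sdiff_add [DecidableEq ι] {M : Finset ι} (hM : M ⊆ J) (x : ℝ) :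
    countBelow (J \ M) s x + countBelow M s x = countBelow J s x := by
  rw [countBelow, countBelow, countBelow, ← Finset.card_union_of_disjoint, ← Finset.filter_union,
    Finset.sdiff_union_of_subset hM]
  exact Finset.disjoint_filter_filter Finset.sdiff_disjoint

/-- This decouples the interior: on the right, each point of `M` is tested only against the points
outside `M`, so the condition is a product event once those are fixed. -/
theorem eq_rankInterior_iff [DecidableEq ι] (hs : Function.Injective s) {p q : ℕ}
    (hpq : p < q) (hq : q ≤ J.card + 1) {M : Finset ι} (hM : M ⊆ J) (hcard : M.card = q - p - 1) :
    M = rankInterior J s p q ↔ ∀ i ∈ M, countBelow (J \ M) s (s i) = p := by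
  constructor
  · rintro rfl i hi
    rw [countBelow_sdiff_rankInterior_eq_iff hs hpq]
    have := (Finset.mem_filter.1 hi).2
    omega
  · intro h
    refine Finset.eq_of_subset_of_card_le (fun i hi => ?_)
      (by rw [card_rankInterior hs hq, hcard])
    refine Finset.mem_filter.2 ⟨hM hi, ?_⟩
    -- Of the points of `J` below `s i`, exactly `p` lie outside `M` and at most `|M| - 1 = q - p -
    -- 2` inside, as `i` is not below itself; the rank is thus between `p` and `q - 2`.
    have h1 := countBelow_sdiff_add (s := s) hM (s i)
    rw [h i hi] at h1
    have h2 : countBelow M s (s i) < M.card :=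
      Finset.card_lt_card (Finset.ssubset_iff_of_subset (Finset.filter_subset _ _) |>.2
        ⟨i, hi, by simp⟩)
    omega

end Ranks

/-! ### Spacing of the bin edges -/

theorem edgeRank_zero (N B : ℕ) : edgeRank N B 0 = 0 := by simp [edgeRank]

theorem edgeRank_self (N : ℕ) {B : ℕ} (hB : B ≠ 0) : edgeRank N B B = N + 1 := by
  have : (B : ℝ) ≠ 0 := by exact_mod_cast hB
  rw [edgeRank, mul_div_cancel_left₀ _ this]
  exact_mod_cast Nat.ceil_natCast (R := ℝ) (N + 1)

theorem edgeRank_mono (N B : ℕ) : Monotone (edgeRank N B) := by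
  intro b b' h
  unfold edgeRank
  gcongr

/-- Before rounding, consecutive edges are `(N + 1) / ⌊N / k⌋ ≥ k` apart, and adding the integer `k`
commutes with the ceiling. A bin thus has at least `k - 1` points strictly between its edges. -/
theorem edgeRank_add_le (N : ℕ) {k b : ℕ} (hb : b < N / k) :
    edgeRank N (N / k) b + k ≤ edgeRank N (N / k) (b + 1) := by
  have hB : (0 : ℝ) < (N / k : ℕ) := by exact_mod_cast (Nat.zero_le b).trans_lt hb
  rw [edgeRank, edgeRank, ← Nat.ceil_add_natCast (by positivity)]
  refine Nat.ceil_mono ?_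
  have : ((N / k : ℕ) : ℝ) * k ≤ N := by exact_mod_cast Nat.div_mul_le_self N k
  rw [← sub_nonneg]
  have e : ((b + 1 : ℕ) : ℝ) * ((N : ℝ) + 1) / (N / k : ℕ) -
      ((b : ℝ) * ((N : ℝ) + 1) / (N / k : ℕ) + k) =
      ((N : ℝ) + 1 - (N / k : ℕ) * k) / (N / k : ℕ) := by
    push_cast
    field_simp
    ring
  rw [e]
  exact div_nonneg (by linarith) hB.le

theorem edgeRank_succ_le (N : ℕ) {B b : ℕ} (hb : b < B) : edgeRank N B (b + 1) ≤ N + 1 :=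
  (edgeRank_mono N B hb).trans_eq (edgeRank_self N (by omega))

theorem MeasurableSet.setOf_and {α : Type*} [MeasurableSpace α] {p q : α → Prop}
    (hp : MeasurableSet {x | p x}) (hq : MeasurableSet {x | q x}) :
    MeasurableSet {x | p x ∧ q x} :=
  hp.inter hq

/-- The random index sets (class members, bin interiors) take finitely many values, so measurability
need only be checked with the index set frozen. -/
theorem measurable_of_countable_cases {α β γ : Type*} [MeasurableSpace α] [MeasurableSpace β]
    [Countable γ] {c : α → γ} (hc : ∀ m, MeasurableSet {x | c x = m}) {F : γ → α → β}
    (hF : ∀ m, Measurable (F m)) : Measurable fun x => F (c x) x := by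
  intro s hs
  have : (fun x => F (c x) x) ⁻¹' s = ⋃ m, {x | c x = m} ∩ F m ⁻¹' s := by
    ext x
    simp
  rw [this]
  exact MeasurableSet.iUnion fun m => (hc m).inter (hF m hs)

/-! ### Conditional law of the interior of one bin -/

section Bins

variable {Z : Type*} {n L : ℕ} (κ : Z → Fin L) (S : Z → ℝ)

/-- The indices of the points of class `l`. -/
def classSet (l : Fin L) (z : Fin n → Z) : Finset (Fin n) := {i | κ (z i) = l}

/-- The queries of class `l` with at least `p` and less than `q` points of `J` of lower score. -/
def countBin (l : Fin L) (J : Finset (Fin n)) (p q : ℕ) (z : Fin n → Z) : Set Z :=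
  {y | κ y = l ∧ p ≤ countBelow J (S ∘ z) (S y) ∧ countBelow J (S ∘ z) (S y) < q}

/-- The vectors of points with prescribed classes. -/
def classCell (a : Fin n → Fin L) : Set (Fin n → Z) := {z | ∀ i, κ (z i) = a i}

variable {κ S}

theorem classSet_eq_of_mem_classCell {a : Fin n → Fin L} {z : Fin n → Z}
    (hz : z ∈ classCell κ a) (l : Fin L) :
    classSet κ l z = Finset.univ.filter (a · = l) := by
  ext i
  have h : κ (z i) = a i := hz i
  simp [classSet, h]

variable [MeasurableSpace Z]

theorem measurable_countBelow {α : Type*} [MeasurableSpace α] (J : Finset (Fin n))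
    {s : α → Fin n → ℝ} (hs : ∀ i, Measurable fun a => s a i) {x : α → ℝ} (hx : Measurable x) :
    Measurable fun a => countBelow J (s a) (x a) := by
  simp only [countBelow, Finset.card_filter]
  refine Finset.measurable_sum _ fun i _ => ?_
  exact Measurable.ite (measurableSet_lt (hs i) hx) measurable_const measurable_const

theorem measurableSet_rankInterior_eq (J : Finset (Fin n)) {s : Z → Fin n → ℝ}
    (hs : ∀ i, Measurable fun a => s a i) (p q : ℕ) (M : Finset (Fin n)) :
    MeasurableSet {z | rankInterior J (s z) p q = M} := by
  have : {z | rankInterior J (s z) p q = M} = ⋂ i, {z | (i ∈ J ∧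
      p ≤ countBelow J (s z) (s z i) ∧ countBelow J (s z) (s z i) + 1 < q) ↔ i ∈ M} := by
    ext z
    simp [Finset.ext_iff, rankInterior]
  rw [this]
  refine MeasurableSet.iInter fun i => ?_
  have h := measurable_countBelow J hs (hs i)
  refine MeasurableSet.iff (MeasurableSet.setOf_and (MeasurableSet.const _) (MeasurableSet.setOf_and ?_ ?_))
    (MeasurableSet.const _)
  · exact measurableSet_le measurable_const h
  · exact measurableSet_lt (h.add_const 1) measurable_const

theorem measurableSet_class (hκ : Measurable κ) (l : Fin L) : MeasurableSet {y | κ y = l} :=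
  hκ (measurableSet_singleton l)

theorem measurableSet_classCell (hκ : Measurable κ) (a : Fin n → Fin L) :
    MeasurableSet (classCell κ a) := by
  simp only [classCell, Set.ofPred_forall]
  exact MeasurableSet.iInter fun i => (hκ.comp (measurable_pi_apply i)) (measurableSet_singleton (a i))

theorem measurableSet_countBin_prod (hκ : Measurable κ) (hS : Measurable S) (l : Fin L)
    (J : Finset (Fin n)) (p q : ℕ) :
    MeasurableSet {x : (Fin n → Z) × Z | x.2 ∈ countBin κ S l J p q x.1} := by
  have h : Measurable fun x : (Fin n → Z) × Z => countBelow J (S ∘ x.1) (S x.2) :=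
    measurable_countBelow J (fun i => by simp only [Function.comp]; fun_prop) (by fun_prop)
  refine MeasurableSet.setOf_and (measurable_snd (measurableSet_class hκ l)) (MeasurableSet.setOf_and ?_ ?_)
  · exact measurableSet_le measurable_const h
  · exact measurableSet_lt h measurable_const

theorem measurableSet_countBin (hκ : Measurable κ) (hS : Measurable S) (l : Fin L)
    (J : Finset (Fin n)) (p q : ℕ) (z : Fin n → Z) : MeasurableSet (countBin κ S l J p q z) :=
  measurable_prodMk_left (measurableSet_countBin_prod hκ hS l J p q)

variable {t : Set Z}

/-- Split the cell according to the value `M` of the interior. Each piece is, up to a null set, the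
event that the points of `M` lie in the region `R M`, intersected with the event `F M` fixing the
classes of the other points; both `R M` and `F M` depend only on coordinates outside `M`, so
`lintegral_mul_loss_le` applies. -/
theorem lintegral_countBin_loss_le (Q : Measure Z) [IsProbabilityMeasure Q] (hκ : Measurable κ)
    (hS : Measurable S) (ht : MeasurableSet t)
    (hinj : ∀ᵐ z ∂(Measure.pi fun _ : Fin n => Q), Function.Injective (S ∘ z))
    (a : Fin n → Fin L) {l : Fin L} {J : Finset (Fin n)} (hJ : J = Finset.univ.filter (a · = l))
    {p q : ℕ} (hpq : p + 2 ≤ q) (hq : q ≤ J.card + 1) {wt : ENNReal → ENNReal}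
    (hwt : Measurable wt) {ψ : ℝ → ℝ → ENNReal} (hψ : Measurable (Function.uncurry ψ)) {C : ENNReal}
    (hC : CondLossBound Q t ψ (q - p - 1) C) :
    ∫⁻ z in classCell κ a, wt (Q (countBin κ S l J p q z)) *
        ψ (hitMean t (rankInterior J (S ∘ z) p q) z) (Q[|countBin κ S l J p q z].real t)
        ∂(Measure.pi fun _ => Q) ≤
      C * ∫⁻ z in classCell κ a, wt (Q (countBin κ S l J p q z)) ∂(Measure.pi fun _ => Q) := by
  set μ := Measure.pi fun _ : Fin n => Q
  set 𝓜 := J.powersetCard (q - p - 1)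
  set R : Finset (Fin n) → (Fin n → Z) → Set Z := fun M z =>
    {y | κ y = l ∧ countBelow (J \ M) (S ∘ z) (S y) = p}
  set F : Finset (Fin n) → Set (Fin n → Z) := fun M => {z | ∀ i, i ∉ M → κ (z i) = a i}
  set A : Finset (Fin n) → Set (Fin n → Z) := fun M =>
    {z | z ∈ classCell κ a ∧ rankInterior J (S ∘ z) p q = M}
  have hSz : ∀ i : Fin n, Measurable fun z : Fin n → Z => (S ∘ z) i := fun i => by
    simp only [Function.comp]; fun_prop
  have hA : ∀ M, MeasurableSet (A M) := fun M => (measurableSet_classCell hκ a).inter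
    (measurableSet_rankInterior_eq J hSz p q M)
  have hF : ∀ M, MeasurableSet (F M) := fun M => by
    simp only [F, Set.ofPred_forall]
    exact MeasurableSet.iInter fun i => MeasurableSet.iInter fun _ =>
      (hκ.comp (measurable_pi_apply i)) (measurableSet_singleton (a i))
  have hRm : ∀ M, MeasurableSet {x : (Fin n → Z) × Z | x.2 ∈ R M x.1} := fun M => by
    have h : Measurable fun x : (Fin n → Z) × Z => countBelow (J \ M) (S ∘ x.1) (S x.2) :=
      measurable_countBelow (J \ M) (fun i => by simp only [Function.comp]; fun_prop) (by fun_prop)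
    exact MeasurableSet.setOf_and (measurable_snd (measurableSet_class hκ l))
      (h (measurableSet_singleton p))
  have hcover : (classCell κ a : Set (Fin n → Z)) =ᵐ[μ] ⋃ M ∈ 𝓜, A M := by
    filter_upwards [hinj] with z hz
    refine propext ⟨fun h => ?_, fun h => ?_⟩
    · exact Set.mem_iUnion₂.2 ⟨rankInterior J (S ∘ z) p q, Finset.mem_powersetCard.2
        ⟨rankInterior_subset _ _ _ _, card_rankInterior hz hq⟩, h, rfl⟩
    · obtain ⟨M, _, h⟩ := Set.mem_iUnion₂.1 h
      exact h.1
  have hdisj : (𝓜 : Set (Finset (Fin n))).PairwiseDisjoint A := by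
    intro M _ M' _ hne
    exact Set.disjoint_left.2 fun z h h' => hne (h.2.symm.trans h'.2)
  -- The classes of the points in `M` are all `l` because `M ⊆ J`; that part of the cell condition
  -- is absorbed in `R M`, the rest is `F M`.
  have hAE : ∀ M ∈ 𝓜, A M =ᵐ[μ] ({z | ∀ i ∈ M, z i ∈ R M z} ∩ F M : Set (Fin n → Z)) := by
    intro M hM
    obtain ⟨hMJ, hMc⟩ := Finset.mem_powersetCard.1 hM
    filter_upwards [hinj] with z hz
    have key := eq_rankInterior_iff hz (by omega) hq hMJ hMc
    refine propext ⟨fun h => ⟨fun i hi => ⟨?_, ?_⟩, fun i _ => h.1 i⟩, fun h => ⟨fun i => ?_, ?_⟩⟩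
    · have := hMJ hi
      rw [hJ] at this
      exact (h.1 i).trans (Finset.mem_filter.1 this).2
    · exact key.1 h.2.symm i hi
    · by_cases hi : i ∈ M
      · have := hMJ hi
        rw [hJ] at this
        exact (h.1 i hi).1.trans (Finset.mem_filter.1 this).2.symm
      · exact h.2 i hi
    · exact (key.2 fun i hi => (h.1 i hi).2).symm
  -- The region tested by the points of `M` is the very bin that queries fall into, so the sampled
  -- law and the target probability match.
  have hbin : ∀ M, ∀ᵐ z ∂μ, z ∈ A M → countBin κ S l J p q z = R M z := by
    intro M
    filter_upwards [hinj] with z hz h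
    ext y
    have := countBelow_sdiff_rankInterior_eq_iff (J := J) hz (show p < q by omega) (S y)
    rw [h.2] at this
    exact and_congr_right fun _ => this.symm
  rw [setLIntegral_congr hcover, setLIntegral_congr hcover,
    lintegral_biUnion_finset hdisj fun M _ => hA M, lintegral_biUnion_finset hdisj fun M _ => hA M,
    Finset.mul_sum]
  refine Finset.sum_le_sum fun M hM => ?_
  obtain ⟨hMJ, hMc⟩ := Finset.mem_powersetCard.1 hM
  have hMne : M.Nonempty := Finset.card_pos.1 (by omega)
  have hRinv : ∀ (x : Fin n → Z) (y : M → Z), R M (Function.updateFinset x M y) = R M x := by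
    intro x y
    ext v
    have : countBelow (J \ M) (S ∘ Function.updateFinset x M y) (S v) =
        countBelow (J \ M) (S ∘ x) (S v) := by
      unfold countBelow
      congr 1
      refine Finset.filter_congr fun i hi => ?_
      have hi' := (Finset.mem_sdiff.1 hi).2
      simp [Function.updateFinset, hi']
    exact and_congr_right fun _ => by rw [this]
  have hFinv : ∀ (x : Fin n → Z) (y : M → Z), Function.updateFinset x M y ∈ F M ↔ x ∈ F M := by
    intro x y
    refine forall_congr' fun i => forall_congr' fun hi => ?_
    simp [Function.updateFinset, hi]
  have hQR : Measurable fun z => wt (Q (R M z)) := hwt.comp (measurable_measure_prodMk_left (hRm M))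
  have main := lintegral_mul_loss_le Q hMne ht (hRm M) hRinv
    (w := (F M).indicator fun z => wt (Q (R M z))) (hQR.indicator (hF M))
    (fun x y => by
      by_cases hx : x ∈ F M
      · rw [Set.indicator_of_mem hx, Set.indicator_of_mem ((hFinv x y).2 hx), hRinv]
      · rw [Set.indicator_of_notMem hx, Set.indicator_of_notMem (mt (hFinv x y).1 hx)])
    hψ (hMc.symm ▸ hC)
  have e2 : ∫⁻ z in A M, wt (Q (countBin κ S l J p q z)) ∂μ =
      ∫⁻ z in {z | ∀ i ∈ M, z i ∈ R M z}, (F M).indicator (fun z => wt (Q (R M z))) z ∂μ := by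
    rw [lintegral_indicator (hF M), Measure.restrict_restrict (hF M), Set.inter_comm,
      ← setLIntegral_congr (hAE M hM)]
    refine setLIntegral_congr_fun_ae (hA M) ?_
    filter_upwards [hbin M] with z hz h
    rw [hz h]
  have e1 : ∫⁻ z in A M, wt (Q (countBin κ S l J p q z)) *
        ψ (hitMean t (rankInterior J (S ∘ z) p q) z) (Q[|countBin κ S l J p q z].real t) ∂μ =
      ∫⁻ z in {z | ∀ i ∈ M, z i ∈ R M z}, (F M).indicator (fun z => wt (Q (R M z))) z *
        ψ (hitMean t M z) (Q[|R M z].real t) ∂μ := by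
    have : (fun z => (F M).indicator (fun z => wt (Q (R M z))) z *
        ψ (hitMean t M z) (Q[|R M z].real t)) = (F M).indicator fun z => wt (Q (R M z)) *
        ψ (hitMean t M z) (Q[|R M z].real t) := by
      ext z
      rw [Set.indicator_mul_left]
    rw [this, lintegral_indicator (hF M), Measure.restrict_restrict (hF M), Set.inter_comm,
      ← setLIntegral_congr (hAE M hM)]
    refine setLIntegral_congr_fun_ae (hA M) ?_
    filter_upwards [hbin M] with z hz h
    rw [hz h, h.2]
  rw [e1, e2]
  exact main

end Bins

/-! ### The bins of all classes -/

section ClassBins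

variable {Z : Type*} {n L : ℕ} (κ : Z → Fin L) (S : Z → ℝ) (k : ℕ)

/-- Bin `b` of class `l`, described by numbers of points with lower score. -/
def classBin (l : Fin L) (b : ℕ) (z : Fin n → Z) : Set Z :=
  countBin κ S l (classSet κ l z)
    (edgeRank (classSet κ l z).card ((classSet κ l z).card / k) b)
    (edgeRank (classSet κ l z).card ((classSet κ l z).card / k) (b + 1)) z

/-- The points strictly inside bin `b` of class `l`. -/
noncomputable def classBinPoints (l : Fin L) (b : ℕ) (z : Fin n → Z) : Finset (Fin n) :=
  rankInterior (classSet κ l z) (S ∘ z)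
    (edgeRank (classSet κ l z).card ((classSet κ l z).card / k) b)
    (edgeRank (classSet κ l z).card ((classSet κ l z).card / k) (b + 1))

/-- The sum over all bins of all classes. -/
def binSum {M : Type*} [AddCommMonoid M] (z : Fin n → Z) (f : Fin L → ℕ → M) : M :=
  ∑ l, ∑ b ∈ Finset.range ((classSet κ l z).card / k), f l b

theorem sum_card_classSet (z : Fin n → Z) : ∑ l, (classSet κ l z).card = n := by
  have := Finset.card_eq_sum_card_fiberwise (s := Finset.univ) (t := Finset.univ)
    (f := fun i => κ (z i)) fun i _ => Finset.mem_coe.2 (Finset.mem_univ _)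
  simpa [classSet] using this.symm

/-- Since `⌊n_l / k⌋ ≤ n_l / k` and the class counts add up to `n`; this total number of bins is the
factor in the union bound. -/
theorem binSum_one_le (z : Fin n → Z) :
    binSum κ k z (fun _ _ => (1 : ENNReal)) ≤ ENNReal.ofReal (n / k) := by
  have h : binSum κ k z (fun _ _ => (1 : ENNReal)) =
      ENNReal.ofReal (∑ l, (((classSet κ l z).card / k : ℕ) : ℝ)) := by
    rw [ENNReal.ofReal_sum_of_nonneg fun _ _ => by positivity]
    simp [binSum]
  rw [h]
  refine ENNReal.ofReal_le_ofReal ?_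
  calc _ ≤ ∑ l, ((classSet κ l z).card : ℝ) / k := Finset.sum_le_sum fun l _ => Nat.cast_div_le
    _ = n / k := by
      rw [← Finset.sum_div]
      congr 1
      exact_mod_cast sum_card_classSet κ z

theorem classBin_disjoint {l l' : Fin L} {b b' : ℕ} (z : Fin n → Z)
    (h : (l, b) ≠ (l', b')) : Disjoint (classBin κ S k l b z) (classBin κ S k l' b' z) := by
  refine Set.disjoint_left.2 fun y hy hy' => h ?_
  have hl : l = l' := hy.1.symm.trans hy'.1
  subst hl
  have h1 := hy.2
  have h2 := hy'.2
  have hb : b = b' := by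
    rcases lt_trichotomy b b' with hlt | heq | hlt
    · have := edgeRank_mono (classSet κ l z).card ((classSet κ l z).card / k)
        (show b + 1 ≤ b' from hlt)
      omega
    · exact heq
    · have := edgeRank_mono (classSet κ l z).card ((classSet κ l z).card / k)
        (show b' + 1 ≤ b from hlt)
      omega
  rw [hb]

variable [MeasurableSpace Z] {κ S}

theorem measurableSet_classBin (hκ : Measurable κ) (hS : Measurable S) (l : Fin L) (b : ℕ)
    (z : Fin n → Z) : MeasurableSet (classBin κ S k l b z) :=
  measurableSet_countBin hκ hS _ _ _ _ z

theorem binSum_measure_le (Q : Measure Z) [IsProbabilityMeasure Q] (hκ : Measurable κ)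
    (hS : Measurable S) (z : Fin n → Z) :
    binSum κ k z (fun l b => Q (classBin κ S k l b z)) ≤ 1 := by
  rw [binSum, Finset.sum_sigma', ← measure_univ (μ := Q)]
  refine sum_measure_le_measure_univ
    (fun i _ => (measurableSet_classBin k hκ hS i.1 i.2 z).nullMeasurableSet) ?_
  rintro ⟨l, b⟩ _ ⟨l', b'⟩ _ hne
  refine (classBin_disjoint κ S k z ?_).aedisjoint
  rintro h
  cases h
  exact hne rfl

theorem measurable_measure_countBin (Q : Measure Z) [IsProbabilityMeasure Q] (hκ : Measurable κ)
    (hS : Measurable S) (l : Fin L) (J : Finset (Fin n)) (p q : ℕ) :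
    Measurable fun z => Q (countBin κ S l J p q z) :=
  measurable_measure_prodMk_left (measurableSet_countBin_prod hκ hS l J p q)

theorem measurable_cond_countBin (Q : Measure Z) [IsProbabilityMeasure Q] (hκ : Measurable κ)
    (hS : Measurable S) {t : Set Z} (ht : MeasurableSet t) (l : Fin L) (J : Finset (Fin n))
    (p q : ℕ) : Measurable fun z => Q[|countBin κ S l J p q z].real t := by
  have h1 : Measurable fun z => Q (countBin κ S l J p q z ∩ t) :=
    measurable_measure_prodMk_left
      ((measurableSet_countBin_prod hκ hS l J p q).inter (measurable_snd ht))
  simp only [Measure.real, fun z => cond_apply (measurableSet_countBin hκ hS l J p q z) Q t]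
  exact ((measurable_measure_countBin Q hκ hS l J p q).inv.mul h1).ennreal_toReal

theorem measurable_hitMean_rankInterior (hS : Measurable S) {t : Set Z} (ht : MeasurableSet t)
    (J : Finset (Fin n)) (p q : ℕ) :
    Measurable fun z => hitMean t (rankInterior J (S ∘ z) p q) z :=
  measurable_of_countable_cases (c := fun z : Fin n → Z => rankInterior J (S ∘ z) p q)
    (measurableSet_rankInterior_eq J (fun i => by simp only [Function.comp]; fun_prop) p q)
    (F := fun M z => hitMean t M z) fun M => measurable_hitMean ht M

theorem measurableSet_classSet_eq (hκ : Measurable κ) (l : Fin L) (J : Finset (Fin n)) :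
    MeasurableSet {z : Fin n → Z | classSet κ l z = J} := by
  have : {z : Fin n → Z | classSet κ l z = J} = ⋂ i, {z | κ (z i) = l ↔ i ∈ J} := by
    ext z
    simp [Finset.ext_iff, classSet]
  rw [this]
  exact MeasurableSet.iInter fun i => MeasurableSet.iff
    ((hκ.comp (measurable_pi_apply i)) (measurableSet_singleton l)) (MeasurableSet.const _)

theorem measurable_measure_classBin (Q : Measure Z) [IsProbabilityMeasure Q] (hκ : Measurable κ)
    (hS : Measurable S) (l : Fin L) (b : ℕ) :
    Measurable fun z : Fin n → Z => Q (classBin κ S k l b z) :=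
  measurable_of_countable_cases (measurableSet_classSet_eq hκ l)
    (F := fun J z => Q (countBin κ S l J (edgeRank J.card (J.card / k) b)
      (edgeRank J.card (J.card / k) (b + 1)) z))
    fun J => measurable_measure_countBin Q hκ hS l J _ _

theorem measurable_cond_classBin (Q : Measure Z) [IsProbabilityMeasure Q] (hκ : Measurable κ)
    (hS : Measurable S) {t : Set Z} (ht : MeasurableSet t) (l : Fin L) (b : ℕ) :
    Measurable fun z : Fin n → Z => Q[|classBin κ S k l b z].real t :=
  measurable_of_countable_cases (measurableSet_classSet_eq hκ l)
    (F := fun J z => Q[|countBin κ S l J (edgeRank J.card (J.card / k) b)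
      (edgeRank J.card (J.card / k) (b + 1)) z].real t)
    fun J => measurable_cond_countBin Q hκ hS ht l J _ _

theorem measurable_hitMean_classBinPoints (hκ : Measurable κ) (hS : Measurable S) {t : Set Z}
    (ht : MeasurableSet t) (l : Fin L) (b : ℕ) :
    Measurable fun z : Fin n → Z => hitMean t (classBinPoints κ S k l b z) z :=
  measurable_of_countable_cases (measurableSet_classSet_eq hκ l)
    (F := fun J z => hitMean t (rankInterior J (S ∘ z) (edgeRank J.card (J.card / k) b)
      (edgeRank J.card (J.card / k) (b + 1))) z)
    fun J => measurable_hitMean_rankInterior hS ht J _ _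

theorem measurable_binSum {M α : Type*} [AddCommMonoid M] [MeasurableSpace M] [MeasurableAdd₂ M]
    [MeasurableSpace α] (hκ : Measurable κ) {z : α → Fin n → Z} (hz : Measurable z)
    {f : α → Fin L → ℕ → M} (hf : ∀ l b, Measurable fun x => f x l b) :
    Measurable fun x => binSum κ k (z x) (f x) := by
  refine Finset.measurable_sum _ fun l _ => ?_
  refine measurable_of_countable_cases (c := fun x => classSet κ l (z x))
    (F := fun J x => ∑ b ∈ Finset.range (J.card / k), f x l b)
    (fun J => hz (measurableSet_classSet_eq hκ l J)) fun J => ?_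
  exact Finset.measurable_sum _ fun b _ => hf l b

/-- The total loss of the bins: `ψ` compares the label frequency in a bin with the probability of
`t` given this bin, and `wt` is the weight of a bin in terms of its probability. -/
noncomputable def binLoss (Q : Measure Z) (κ : Z → Fin L) (S : Z → ℝ) (t : Set Z) (k : ℕ)
    (wt : ENNReal → ENNReal) (ψ : ℝ → ℝ → ENNReal) (z : Fin n → Z) : ENNReal :=
  binSum κ k z fun l b => wt (Q (classBin κ S k l b z)) *
    ψ (hitMean t (classBinPoints κ S k l b z) z) (Q[|classBin κ S k l b z].real t)

theorem measurable_binLoss (Q : Measure Z) [IsProbabilityMeasure Q] (hκ : Measurable κ)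
    (hS : Measurable S) {t : Set Z} (ht : MeasurableSet t) {wt : ENNReal → ENNReal}
    (hwt : Measurable wt) {ψ : ℝ → ℝ → ENNReal} (hψ : Measurable (Function.uncurry ψ)) :
    Measurable (binLoss (n := n) Q κ S t k wt ψ) :=
  measurable_binSum k hκ measurable_id fun l b =>
    (hwt.comp (measurable_measure_classBin k Q hκ hS l b)).mul
      (hψ.comp ((measurable_hitMean_classBinPoints k hκ hS ht l b).prodMk
        (measurable_cond_classBin k Q hκ hS ht l b)))

/-- An event in terms of the classes is a finite disjoint union of cells with prescribed classes. On
a cell the index sets and edges are deterministic, so the one-bin estimate can be summed; `C` is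
common to all bins because each has at least `k - 1` interior points. -/
theorem lintegral_binLoss_le (Q : Measure Z) [IsProbabilityMeasure Q] (hκ : Measurable κ)
    (hS : Measurable S) {t : Set Z} (ht : MeasurableSet t)
    (hinj : ∀ᵐ z ∂(Measure.pi fun _ : Fin n => Q), Function.Injective (S ∘ z)) (hk : 2 ≤ k)
    (A : Set (Fin n → Fin L)) {wt : ENNReal → ENNReal}
    (hwt : Measurable wt) {ψ : ℝ → ℝ → ENNReal} (hψ : Measurable (Function.uncurry ψ)) {C : ENNReal}
    (hC : ∀ m, k - 1 ≤ m → CondLossBound Q t ψ m C) :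
    ∫⁻ z in {z | (fun i => κ (z i)) ∈ A}, binLoss Q κ S t k wt ψ z ∂(Measure.pi fun _ => Q) ≤
      C * ∫⁻ z in {z | (fun i => κ (z i)) ∈ A},
        binSum κ k z (fun l b => wt (Q (classBin κ S k l b z))) ∂(Measure.pi fun _ => Q) := by
  classical
  set μ := Measure.pi fun _ : Fin n => Q
  have hA : {z : Fin n → Z | (fun i => κ (z i)) ∈ A} =
      ⋃ a ∈ Finset.univ.filter (· ∈ A), classCell κ a := by
    ext z
    simp only [Set.mem_iUnion, Finset.mem_filter, Finset.mem_univ, true_and, exists_prop]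
    constructor
    · exact fun h => ⟨_, h, fun i => rfl⟩
    · rintro ⟨a, ha, h⟩
      have h' : (fun i => κ (z i)) = a := funext h
      exact Set.mem_ofPred_eq ▸ (h' ▸ ha)
  have hdisj : ((Finset.univ.filter (· ∈ A) : Finset (Fin n → Fin L)) :
      Set (Fin n → Fin L)).PairwiseDisjoint (classCell κ) := by
    intro a _ a' _ hne
    exact Set.disjoint_left.2 fun z h h' => hne (funext fun i => (h i).symm.trans (h' i))
  rw [hA, lintegral_biUnion_finset hdisj fun a _ => measurableSet_classCell hκ a,
    lintegral_biUnion_finset hdisj fun a _ => measurableSet_classCell hκ a, Finset.mul_sum]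
  refine Finset.sum_le_sum fun a _ => ?_
  set J : Fin L → Finset (Fin n) := fun l => Finset.univ.filter (a · = l) with hJ
  have hcl : ∀ z ∈ classCell κ a, ∀ l, classSet κ l z = J l := fun z hz l =>
    classSet_eq_of_mem_classCell hz l
  set p : Fin L → ℕ → ℕ := fun l b => edgeRank (J l).card ((J l).card / k) b
  rw [setLIntegral_congr_fun (g := fun z => ∑ l, ∑ b ∈ Finset.range ((J l).card / k),
        wt (Q (countBin κ S l (J l) (p l b) (p l (b + 1)) z)) *
          ψ (hitMean t (rankInterior (J l) (S ∘ z) (p l b) (p l (b + 1))) z)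
            (Q[|countBin κ S l (J l) (p l b) (p l (b + 1)) z].real t))
      (measurableSet_classCell hκ a)
      (fun z hz => by simp only [binLoss, binSum, classBin, classBinPoints, hcl z hz, p]),
    setLIntegral_congr_fun (f := fun z => binSum κ k z fun l b => wt (Q (classBin κ S k l b z)))
      (g := fun z => ∑ l, ∑ b ∈ Finset.range ((J l).card / k),
        wt (Q (countBin κ S l (J l) (p l b) (p l (b + 1)) z)))
      (measurableSet_classCell hκ a)
      (fun z hz => by simp only [binSum, classBin, hcl z hz, p])]
  have hm1 : ∀ l J p q, Measurable fun z : Fin n → Z => wt (Q (countBin κ S l J p q z)) :=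
    fun l J p q => hwt.comp (measurable_measure_countBin Q hκ hS l J p q)
  have hm2 : ∀ l J p q, Measurable fun z : Fin n → Z => wt (Q (countBin κ S l J p q z)) *
      ψ (hitMean t (rankInterior J (S ∘ z) p q) z) (Q[|countBin κ S l J p q z].real t) :=
    fun l J p q => (hm1 l J p q).mul (hψ.comp
      ((measurable_hitMean_rankInterior hS ht J p q).prodMk
        (measurable_cond_countBin Q hκ hS ht l J p q)))
  rw [lintegral_finsetSum _ fun l _ => Finset.measurable_sum _ fun b _ => hm2 _ _ _ _,
    lintegral_finsetSum _ fun l _ => Finset.measurable_sum _ fun b _ => hm1 _ _ _ _,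
    Finset.mul_sum]
  refine Finset.sum_le_sum fun l _ => ?_
  rw [lintegral_finsetSum _ fun b _ => hm2 _ _ _ _, lintegral_finsetSum _ fun b _ => hm1 _ _ _ _,
    Finset.mul_sum]
  refine Finset.sum_le_sum fun b hb => ?_
  have hb' := Finset.mem_range.1 hb
  have hedge : p l b + k ≤ p l (b + 1) := edgeRank_add_le _ hb'
  exact lintegral_countBin_loss_le Q hκ hS ht hinj a (hJ ▸ rfl : J l = _) (p := p l b)
    (q := p l (b + 1)) (by omega) (edgeRank_succ_le _ hb') hwt hψ (hC _ (by omega))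

end ClassBins

/-! ### Predictors with finitely many values -/

/-- The conditional expectation is a function of `φ`, hence constant on the fibre through `z`;
integrating over this fibre, an atom of positive mass, identifies the constant. The equality
therefore holds pointwise at `z`, for the chosen version. -/
theorem condExp_comap_eq_cond {Z β : Type*} [MeasurableSpace Z] [MeasurableSpace β]
    [MeasurableSingletonClass β] (Q : Measure Z) [IsProbabilityMeasure Q] {φ : Z → β}
    (hφ : Measurable φ) {t : Set Z} (ht : MeasurableSet t) (z : Z)
    (h0 : Q {y | φ y = φ z} ≠ 0) :
    (Q[t.indicator (fun _ => (1 : ℝ)) | MeasurableSpace.comap φ inferInstance]) z =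
      Q[|{y | φ y = φ z}].real t := by
  set f := Q[t.indicator (fun _ => (1 : ℝ)) | MeasurableSpace.comap φ inferInstance]
  have hm : MeasurableSpace.comap φ inferInstance ≤ (inferInstance : MeasurableSpace Z) :=
    hφ.comap_le
  have hA : MeasurableSet[MeasurableSpace.comap φ inferInstance] {y | φ y = φ z} :=
    ⟨{φ z}, measurableSet_singleton _, rfl⟩
  have hA' : MeasurableSet {y | φ y = φ z} := hm _ hA
  have hf : ∀ y ∈ {y | φ y = φ z}, f y = f z := by
    obtain ⟨ψ, _, hψ⟩ := (stronglyMeasurable_condExp (μ := Q)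
      (m := MeasurableSpace.comap φ inferInstance)
      (f := t.indicator (fun _ => (1 : ℝ)))).measurable.exists_eq_measurable_comp
    intro y hy
    have hy : φ y = φ z := hy
    change f = ψ ∘ φ at hψ
    rw [hψ, Function.comp_apply, Function.comp_apply, hy]
  have h1 := setIntegral_condExp (μ := Q) hm ((integrable_const (1 : ℝ)).indicator ht) hA
  rw [setIntegral_congr_fun hA' hf, setIntegral_const, smul_eq_mul,
    setIntegral_indicator ht, setIntegral_const, smul_eq_mul, mul_one] at h1
  have h2 : Q.real {y | φ y = φ z} ≠ 0 := by
    rwa [Ne, measureReal_eq_zero_iff]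
  rw [Measure.real, cond_apply hA', ENNReal.toReal_mul, ENNReal.toReal_inv]
  refine (eq_inv_mul_iff_mul_eq₀ h2).2 ?_
  exact h1

/-- The predictor `f` takes (up to null sets) the distinct values `r l b`, `b < B l`, on the
disjoint sets `W l b` of points of class `l`. -/
structure IsBinnedPredictor {Z : Type*} [MeasurableSpace Z] {L : ℕ} (Q : Measure Z) (κ : Z → Fin L)
    (f : Z → ℝ) (B : Fin L → ℕ) (W : Fin L → ℕ → Set Z) (r : Fin L → ℕ → ℝ) : Prop where
  measurable_class : Measurable κ
  measurable_value : Measurable f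
  measurableSet_bin : ∀ l b, MeasurableSet (W l b)
  class_eq : ∀ l b, ∀ y ∈ W l b, κ y = l
  bin_injective : ∀ l b b' y, y ∈ W l b → y ∈ W l b' → b = b'
  value_injective : ∀ l b b', b < B l → b' < B l → r l b = r l b' → b = b'
  cover : ∀ᵐ y ∂Q, ∃ b < B (κ y), y ∈ W (κ y) b ∧ f y = r (κ y) b

namespace IsBinnedPredictor

variable {Z : Type*} [MeasurableSpace Z] {L : ℕ} {Q : Measure Z}
  {κ : Z → Fin L} {f : Z → ℝ} {B : Fin L → ℕ} {W : Fin L → ℕ → Set Z} {r : Fin L → ℕ → ℝ}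
  {t : Set Z}

/-- Distinct values identify the bin within a class, and almost every point lies in a bin whose
value it receives. This is where noise in the outputs matters: with equal values, two bins would
merge into one level set. -/
theorem level_ae_eq (hf : IsBinnedPredictor Q κ f B W r) {l : Fin L} {b : ℕ} (hb : b < B l) :
    ({y | κ y = l ∧ f y = r l b} : Set Z) =ᵐ[Q] W l b := by
  filter_upwards [hf.cover] with y ⟨b', hb', hy, hfy⟩
  refine propext ⟨?_, fun h => ?_⟩
  · rintro ⟨rfl, h⟩
    rw [hf.value_injective _ _ _ hb hb' (h.symm.trans hfy)]
    exact hy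
  · obtain rfl := hf.class_eq _ _ _ h
    refine ⟨rfl, ?_⟩
    rw [hfy, hf.bin_injective _ _ _ _ hy h]

theorem cond_level (hf : IsBinnedPredictor Q κ f B W r) {l : Fin L} {b : ℕ}
    (hb : b < B l) : Q[|{y | κ y = l ∧ f y = r l b}] = Q[|W l b] := by
  rw [ProbabilityTheory.cond, ProbabilityTheory.cond, Measure.restrict_congr_set (hf.level_ae_eq hb),
    measure_congr (hf.level_ae_eq hb)]

theorem exists_of_level_ne_zero (hf : IsBinnedPredictor Q κ f B W r) {l : Fin L} {v : ℝ}
    (h0 : Q {y | κ y = l ∧ f y = v} ≠ 0) : ∃ b < B l, v = r l b ∧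
      Q[|{y | κ y = l ∧ f y = v}].real t = Q[|W l b].real t := by
  have h : ∃ y, (κ y = l ∧ f y = v) ∧ ∃ b < B (κ y), y ∈ W (κ y) b ∧ f y = r (κ y) b := by
    by_contra hne
    push Not at hne
    refine h0 (measure_mono_null ?_ (ae_iff.1 hf.cover))
    rintro y hy ⟨b, hb, hyb, hfy⟩
    exact hne y hy b hb hyb hfy
  obtain ⟨y, ⟨rfl, rfl⟩, b, hb, _, hfy⟩ := h
  refine ⟨b, hb, hfy, ?_⟩
  rw [hfy, hf.cond_level hb]

theorem sum_indicator_eq (hf : IsBinnedPredictor Q κ f B W r) {M : Type*} [AddCommMonoid M]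
    (G : Fin L → ℕ → M) {y : Z} {b : ℕ} (hb : b < B (κ y)) (hy : y ∈ W (κ y) b) :
    ∑ l, ∑ b ∈ Finset.range (B l), (W l b).indicator (fun _ => G l b) y = G (κ y) b := by
  rw [Finset.sum_eq_single (κ y), Finset.sum_eq_single b, Set.indicator_of_mem hy]
  · intro b' _ hne
    exact Set.indicator_of_notMem (fun h => hne (hf.bin_injective _ _ _ _ h hy)) _
  · exact fun h => absurd (Finset.mem_range.2 hb) h
  · intro l _ hne
    exact Finset.sum_eq_zero fun b' _ =>
      Set.indicator_of_notMem (fun h => hne (hf.class_eq _ _ _ h).symm) _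
  · exact fun h => absurd (Finset.mem_univ _) h

variable [IsProbabilityMeasure Q]

theorem ae_condExp_eq (hf : IsBinnedPredictor Q κ f B W r) (ht : MeasurableSet t) :
    ∀ᵐ y ∂Q, ∃ b < B (κ y), y ∈ W (κ y) b ∧ f y = r (κ y) b ∧
      (Q[t.indicator (fun _ => (1 : ℝ)) |
        MeasurableSpace.comap (fun z => (κ z, f z)) inferInstance]) y =
        Q[|W (κ y) b].real t := by
  -- Discarding the countably many null bins ensures that the level set through `y` has positive
  -- mass, as the pointwise formula requires.
  have hnull : ∀ᵐ y ∂Q, ∀ l b, Q (W l b) = 0 → y ∉ W l b := by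
    rw [ae_all_iff]
    intro l
    rw [ae_all_iff]
    intro b
    by_cases h : Q (W l b) = 0
    · filter_upwards [measure_eq_zero_iff_ae_notMem.1 h] with y hy _ using hy
    · exact ae_of_all _ fun y h' => absurd h' h
  filter_upwards [hf.cover, hnull] with y ⟨b, hb, hy, hfy⟩ hn
  refine ⟨b, hb, hy, hfy, ?_⟩
  have hset : {x | (κ x, f x) = (κ y, f y)} = {x | κ x = κ y ∧ f x = r (κ y) b} := by
    ext x
    simp [hfy]
  have h0 : Q {x | (κ x, f x) = (κ y, f y)} ≠ 0 := by
    rw [hset, measure_congr (hf.level_ae_eq hb)]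
    exact fun h => hn _ _ h hy
  rw [condExp_comap_eq_cond Q (hf.measurable_class.prodMk hf.measurable_value) ht y h0, hset,
    hf.cond_level hb]

theorem integral_abs_condExp_sub (hf : IsBinnedPredictor Q κ f B W r) (ht : MeasurableSet t) :
    ∫ y, |(Q[t.indicator (fun _ => (1 : ℝ)) |
        MeasurableSpace.comap (fun z => (κ z, f z)) inferInstance]) y - f y| ∂Q =
      ∑ l, ∑ b ∈ Finset.range (B l), Q.real (W l b) * |Q[|W l b].real t - r l b| := by
  have h : ∀ᵐ y ∂Q, |(Q[t.indicator (fun _ => (1 : ℝ)) |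
        MeasurableSpace.comap (fun z => (κ z, f z)) inferInstance]) y - f y| =
      ∑ l, ∑ b ∈ Finset.range (B l),
        (W l b).indicator (fun _ => |Q[|W l b].real t - r l b|) y := by
    filter_upwards [hf.ae_condExp_eq ht] with y ⟨b, hb, hy, hfy, hc⟩
    rw [hf.sum_indicator_eq (fun l b => |Q[|W l b].real t - r l b|) hb hy, hc, hfy]
  have hi : ∀ l b, Integrable ((W l b).indicator fun _ => |Q[|W l b].real t - r l b|) Q :=
    fun l b => (integrable_const _).indicator (hf.measurableSet_bin l b)
  rw [integral_congr_ae h, integral_finsetSum _ fun l _ => integrable_finsetSum _ fun b _ => hi l b]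
  refine Finset.sum_congr rfl fun l _ => ?_
  rw [integral_finsetSum _ fun b _ => hi l b]
  refine Finset.sum_congr rfl fun b _ => ?_
  rw [integral_indicator_const _ (hf.measurableSet_bin l b), smul_eq_mul]

theorem measure_abs_condExp_sub_gt_le (hf : IsBinnedPredictor Q κ f B W r) (ht : MeasurableSet t)
    (ε : ℝ) :
    Q {y | |(Q[t.indicator (fun _ => (1 : ℝ)) |
        MeasurableSpace.comap (fun z => (κ z, f z)) inferInstance]) y - f y| ≤ ε}ᶜ ≤
      ∑ l, ∑ b ∈ Finset.range (B l),
        Q (W l b) * if ε < |Q[|W l b].real t - r l b| then 1 else 0 := by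
  set G : Fin L → ℕ → ENNReal := fun l b => if ε < |Q[|W l b].real t - r l b| then 1 else 0
  have hmeas : ∀ l b, Measurable ((W l b).indicator fun _ => G l b) := fun l b =>
    measurable_const.indicator (hf.measurableSet_bin l b)
  have h1 : ∑ l, ∑ b ∈ Finset.range (B l), Q (W l b) * G l b =
      ∫⁻ y, ∑ l, ∑ b ∈ Finset.range (B l), (W l b).indicator (fun _ => G l b) y ∂Q := by
    rw [lintegral_finsetSum _ fun l _ => Finset.measurable_sum _ fun b _ => hmeas l b]
    refine Finset.sum_congr rfl fun l _ => ?_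
    rw [lintegral_finsetSum _ fun b _ => hmeas l b]
    refine Finset.sum_congr rfl fun b _ => ?_
    rw [lintegral_indicator_const (hf.measurableSet_bin l b), mul_comm]
  rw [h1]
  set A := {y | |(Q[t.indicator (fun _ => (1 : ℝ)) |
        MeasurableSpace.comap (fun z => (κ z, f z)) inferInstance]) y - f y| ≤ ε}ᶜ
  have hA : MeasurableSet A := by
    refine (measurableSet_le ?_ measurable_const).compl
    exact ((stronglyMeasurable_condExp.measurable.mono
      (hf.measurable_class.prodMk hf.measurable_value).comap_le le_rfl).sub
      hf.measurable_value).abs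
  rw [← lintegral_indicator_one hA]
  refine lintegral_mono_ae ?_
  filter_upwards [hf.ae_condExp_eq ht] with y ⟨b, hb, hy, hfy, hc⟩
  rw [hf.sum_indicator_eq G hb hy]
  by_cases hyA : y ∈ A
  · have h : ¬ |Q[|W (κ y) b].real t - r (κ y) b| ≤ ε := by
      rw [← hc, ← hfy]; exact hyA
    rw [Set.indicator_of_mem hyA, Pi.one_apply]
    simp only [G]
    rw [if_pos (not_le.1 h)]
  · rw [Set.indicator_of_notMem hyA]
    exact zero_le

end IsBinnedPredictor

/-! ### Order statistics and ranks -/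

section OrderStatistics

variable {ι : Type*} {N : ℕ} {s : ι → ℝ}

theorem countBelow_map {ι' : Type*} (e : ι' ↪ ι) (J : Finset ι') (x : ℝ) :
    countBelow (J.map e) s x = countBelow J (s ∘ e) x := by
  rw [countBelow, Finset.filter_map, Finset.card_map]
  rfl

theorem countBelow_map_strictMono (e : Fin N ↪ ι) (he : StrictMono (s ∘ e)) (i : Fin N) :
    countBelow (Finset.univ.map e) s (s (e i)) = i := by
  rw [countBelow_map, countBelow]
  have : (Finset.univ.filter fun j => (s ∘ e) j < s (e i)) = Finset.Iio i := by
    ext j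
    simpa using he.lt_iff_lt (a := j) (b := i)
  rw [this, Fin.card_Iio]

theorem rankInterior_map_strictMono (e : Fin N ↪ ι) (he : StrictMono (s ∘ e)) (B b : ℕ) :
    rankInterior (Finset.univ.map e) s (edgeRank N B b) (edgeRank N B (b + 1)) =
      (binInterior N B b).map e := by
  rw [rankInterior, Finset.filter_map]
  congr 1
  ext i
  simp only [binInterior, Finset.mem_filter, Finset.mem_univ, true_and, Function.comp_apply,
    countBelow_map_strictMono e he]
  omega

theorem strictMono_comp_sort {s : Fin N → ℝ} (hs : Function.Injective s) :
    StrictMono (s ∘ Tuple.sort s) :=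
  (Tuple.monotone_sort s).strictMono_of_injective (hs.comp (Tuple.sort s).injective)

/-- The conventions at the ends fit the count: `S_(0) = 0` is always at most `x`, and `S_(N+1) = 1`
never is, because `x < 1`. In between, the absence of ties with `x` makes `≤` and `<`
interchangeable. -/
theorem orderStat_le_iff {s : Fin N → ℝ} (hs : Function.Injective s) {x : ℝ}
    (hx : x ∈ Set.Ico (0 : ℝ) 1) (hne : ∀ i, s i ≠ x) (m : ℕ) :
    orderStat s m ≤ x ↔ m ≤ countBelow Finset.univ s x := by
  unfold orderStat
  split_ifs with h0 h
  · simp [h0, hx.1]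
  · rw [(hne _).le_iff_lt, lt_iff_countBelow_lt (J := Finset.univ) (Finset.mem_univ _)]
    have h1 := countBelow_map_strictMono (s := s) (Tuple.sort s).toEmbedding
      (strictMono_comp_sort hs) ⟨m - 1, h⟩
    rw [Finset.univ_map_equiv_to_embedding] at h1
    have h2 : countBelow Finset.univ s (s (Tuple.sort s ⟨m - 1, h⟩)) = m - 1 := h1
    rw [h2]
    omega
  · have := countBelow_le_card Finset.univ s x
    rw [Finset.card_fin] at this
    exact iff_of_false (not_le.2 hx.2) (by omega)

theorem exists_edgeRank_le_lt (N : ℕ) {B c : ℕ} (hB : B ≠ 0) (hc : c ≤ N) :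
    ∃ b < B, edgeRank N B b ≤ c ∧ c < edgeRank N B (b + 1) := by
  have h : ∃ b, c < edgeRank N B (b + 1) :=
    ⟨B - 1, by rw [Nat.sub_add_cancel (by omega), edgeRank_self N hB]; omega⟩
  -- The first bin whose right edge exceeds `c`: minimality puts its left edge at or below `c`, and
  -- the last edge `N + 1` shows that such a bin exists among the `B` bins.
  classical
  refine ⟨Nat.find h, ?_, ?_, Nat.find_spec h⟩
  · have : Nat.find h ≤ B - 1 := Nat.find_min' h (by
      rw [Nat.sub_add_cancel (by omega), edgeRank_self N hB]; omega)
    omega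
  · rcases Nat.eq_zero_or_pos (Nat.find h) with h0 | h0
    · rw [h0, edgeRank_zero]
      exact Nat.zero_le _
    · have := Nat.find_min h (Nat.sub_lt h0 one_pos)
      rw [show Nat.find h - 1 + 1 = Nat.find h by omega] at this
      omega

theorem binaryHistogramBinning_eq {X : Type*} {g : X → ℝ} {D : Fin N → X × Bool} {B : ℕ} {δ : ℝ}
    {U : Fin N → I} {V : Fin B → I} {q : X × I}
    (hs : Function.Injective fun i => jitter δ (g (D i).1) (U i))
    (hq : jitter δ (g q.1) q.2 ∈ Set.Ico (0 : ℝ) 1)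
    (hne : ∀ i, jitter δ (g (D i).1) (U i) ≠ jitter δ (g q.1) q.2) (b : Fin B)
    (hb : edgeRank N B b ≤ countBelow Finset.univ (fun i => jitter δ (g (D i).1) (U i))
        (jitter δ (g q.1) q.2))
    (hb' : countBelow Finset.univ (fun i => jitter δ (g (D i).1) (U i)) (jitter δ (g q.1) q.2) <
      edgeRank N B (b + 1)) :
    binaryHistogramBinning g D B δ U V q =
      jitter δ (binMean (fun i => jitter δ (g (D i).1) (U i)) (fun i => (D i).2) B b) (V b) := by
  have hmem : ∀ b' : Fin B, jitter δ (g q.1) q.2 ∈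
      Set.Ico (orderStat (fun i => jitter δ (g (D i).1) (U i)) (edgeRank N B b'))
        (orderStat (fun i => jitter δ (g (D i).1) (U i)) (edgeRank N B (b' + 1))) ↔ b' = b := by
    intro b'
    rw [Set.mem_Ico, ← not_le, orderStat_le_iff hs hq hne, orderStat_le_iff hs hq hne]
    constructor
    · rintro ⟨h1, h2⟩
      rcases lt_trichotomy b' b with hlt | heq | hlt
      · have := edgeRank_mono N B (show (b' : ℕ) + 1 ≤ b from hlt)
        omega
      · exact heq
      · have := edgeRank_mono N B (show (b : ℕ) + 1 ≤ b' from hlt)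
        omega
    · rintro rfl
      exact ⟨hb, by omega⟩
  unfold binaryHistogramBinning
  simp only
  rw [Finset.sum_eq_single b, Set.indicator_of_mem ((hmem b).2 rfl)]
  · intro b' _ hb'
    exact Set.indicator_of_notMem (mt (hmem b').1 hb') _
  · exact fun h => absurd (Finset.mem_univ _) h

end OrderStatistics

/-! ### Top-label histogram binning as a binned predictor -/

section TopLabel

variable {X : Type*} {L n : ℕ}

/-- The randomized score of a point. -/
noncomputable def jitScore (g : X → Fin L → ℝ) (c : X → Fin L) (δ : ℝ) (z : (X × Fin L) × I) : ℝ :=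
  jitter δ (g z.1.1 (c z.1.1)) z.2

/-- The top class of a point. -/
def topClass (c : X → Fin L) (z : (X × Fin L) × I) : Fin L := c z.1.1

/-- The calibration points together with their uniform variables. -/
def calibrationPoints (ω : CalibrationOutcome X L n) (i : Fin n) : (X × Fin L) × I :=
  (ω.1 i, ω.2.1 i)

/-- The uniform variable that randomizes the output of bin `b` of class `l`. -/
noncomputable def outputNoise (ω : CalibrationOutcome X L n) (l : Fin L) (b : ℕ) : I :=
  -- The default is irrelevant for actual bins, since a class has at most `n` of them.
  if h : b < n then ω.2.2 l ⟨b, h⟩ else 0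

/-- The output of bin `b` of class `l`. -/
noncomputable def binOutput (g : X → Fin L → ℝ) (c : X → Fin L) (k : ℕ) (δ : ℝ)
    (ω : CalibrationOutcome X L n) (l : Fin L) (b : ℕ) : ℝ :=
  jitter δ (hitMean (correctSet c) (classBinPoints (topClass c) (jitScore g c δ) k l b
    (calibrationPoints ω)) (calibrationPoints ω)) (outputNoise ω l b)

theorem univ_map_classPos (c : X → Fin L) (ω : CalibrationOutcome X L n) (l : Fin L) :
    Finset.univ.map ((classIdx c ω.1 l).orderEmbOfFin (rfl : _ = classCount c ω.1 l)).toEmbedding =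
      classSet (topClass c) l (calibrationPoints ω) := by
  rw [← Finset.coe_inj, Finset.coe_map, Finset.coe_univ, Set.image_univ]
  exact Finset.range_orderEmbOfFin (classIdx c ω.1 l) rfl

/-- Links the algorithm, which sorts a re-indexed class sample, with the rank description on the
original indices. Counts of lower scores are unchanged by the embedding of the class positions, and
sorting followed by this embedding carries sorted interior positions to `classBinPoints`. -/
theorem confidence_topLabelHistogramBinning (g : X → Fin L → ℝ) (c : X → Fin L) {k : ℕ}
    (δ : ℝ) (ω : CalibrationOutcome X L n)
    (hinj : Function.Injective (jitScore g c δ ∘ calibrationPoints ω)) (y : (X × Fin L) × I)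
    (hy : jitScore g c δ y ∈ Set.Ico (0 : ℝ) 1)
    (hne : ∀ i, jitScore g c δ (calibrationPoints ω i) ≠ jitScore g c δ y)
    (hk0 : 0 < k) (hk : k ≤ classCount c ω.1 (topClass c y)) :
    ∃ b < (classSet (topClass c) (topClass c y) (calibrationPoints ω)).card / k,
      y ∈ classBin (topClass c) (jitScore g c δ) k (topClass c y) b (calibrationPoints ω) ∧
      confidence (topLabelHistogramBinning g c k δ ω) y =
        binOutput g c k δ ω (topClass c y) b := by
  set l := topClass c y with hl
  set z := calibrationPoints ω
  set S := jitScore g c δ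
  set N := classCount c ω.1 l with hN
  set pos : Fin N ↪ Fin n := ((classIdx c ω.1 l).orderEmbOfFin rfl).toEmbedding
  have hJ : Finset.univ.map pos = classSet (topClass c) l z := univ_map_classPos c ω l
  have hinj' : Function.Injective ((S ∘ z) ∘ pos) := hinj.comp pos.injective
  have hcnt : countBelow (classSet (topClass c) l z) (S ∘ z) (S y) =
      countBelow Finset.univ ((S ∘ z) ∘ pos) (S y) := by
    rw [← hJ, countBelow_map]
  obtain ⟨b, hb, h1, h2⟩ := exists_edgeRank_le_lt N (B := N / k)
    (Nat.div_pos hk hk0).ne' (c := countBelow Finset.univ ((S ∘ z) ∘ pos) (S y))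
    ((countBelow_le_card _ _ _).trans_eq (Finset.card_fin N))
  refine ⟨b, hb, ⟨rfl, ?_⟩, ?_⟩
  · rw [hcnt]
    exact ⟨h1, h2⟩
  · have h := binaryHistogramBinning_eq (g := fun x => g x (c x)) (D := classData c ω.1 l)
      (B := N / k) (δ := δ) (U := fun j => ω.2.1 (classPos c ω.1 l j))
      (V := fun b => ω.2.2 l (Fin.castLE (classCount_div_le c ω.1 l k) b)) (q := (y.1.1, y.2))
      hinj' hy (fun i => hne (pos i)) ⟨b, hb⟩ h1 h2
    refine Eq.trans h ?_
    have hbn : b < n := hb.trans_le (classCount_div_le c ω.1 l k)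
    rw [binOutput, outputNoise, dif_pos hbn]
    congr 1
    -- Enumerates the class members in increasing order of score, as indices of the full sample.
    set τ : Fin N ↪ Fin n := (Tuple.sort ((S ∘ z) ∘ pos)).toEmbedding.trans pos
    have hτ : Finset.univ.map τ = classSet (topClass c) l z := by
      rw [← Finset.map_map, Finset.univ_map_equiv_to_embedding, hJ]
    have hmono : StrictMono ((S ∘ z) ∘ τ) := strictMono_comp_sort hinj'
    have hpts : classBinPoints (topClass c) S k l b z = (binInterior N (N / k) b).map τ := by
      rw [← rankInterior_map_strictMono τ hmono, hτ]
      rfl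
    rw [hpts, hitMean, binMean, Finset.card_map, Finset.sum_map]
    congr 1
    refine Finset.sum_congr rfl fun i _ => ?_
    have hcl : c (ω.1 (τ i)).1 = l := by
      have : τ i ∈ classSet (topClass c) l z := hτ ▸ Finset.mem_map_of_mem τ (Finset.mem_univ i)
      exact (Finset.mem_filter.1 this).2
    by_cases ht : (ω.1 (τ i)).2 = l
    · rw [Set.indicator_of_mem (show z (τ i) ∈ correctSet c from ht.trans hcl.symm)]
      exact if_pos (decide_eq_true ht)
    · rw [Set.indicator_of_notMem (show z (τ i) ∉ correctSet c from
        fun h' => ht (Eq.trans h' hcl))]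
      exact if_neg fun h' => ht (of_decide_eq_true h')

end TopLabel

/-! ### Almost sure properties of the calibration variables -/

theorem jitter_mem_Icc {δ : ℝ} (hδ : 0 < δ) {t : ℝ} (ht : t ∈ Set.Icc (0 : ℝ) 1) (u : I) :
    jitter δ t u ∈ Set.Icc (0 : ℝ) 1 := by
  have hu := u.2
  constructor
  · exact div_nonneg (add_nonneg ht.1 (mul_nonneg hδ.le hu.1)) (by linarith)
  · refine div_le_one_of_le₀ ?_ (by linarith)
    nlinarith [ht.2, hu.2]

theorem abs_jitter_sub_le {δ : ℝ} (hδ : 0 < δ) {t : ℝ} (ht : t ∈ Set.Icc (0 : ℝ) 1) (u : I) :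
    |jitter δ t u - t| ≤ δ := by
  have hu := u.2
  have e : jitter δ t u - t = δ * ((u : ℝ) - t) / (1 + δ) := by
    unfold jitter
    field_simp
    ring
  rw [e, abs_div, abs_mul, abs_of_pos hδ, abs_of_pos (by linarith : 0 < 1 + δ),
    div_le_iff₀ (by linarith)]
  have : |(u : ℝ) - t| ≤ 1 := abs_le.2 ⟨by linarith [hu.1, ht.2], by linarith [hu.2, ht.1]⟩
  nlinarith

theorem measurable_jitter {α : Type*} [MeasurableSpace α] (δ : ℝ) {t : α → ℝ} (ht : Measurable t)
    {u : α → I} (hu : Measurable u) : Measurable fun a => jitter δ (t a) (u a) := by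
  unfold jitter
  fun_prop

/-- Two distinct coordinates have joint law `Q.prod Q`, so Fubini reduces the claim to sections.
Used both for ties of scores and for coincidences of output noise. -/
theorem ae_pair_notMem_of_null_sections {ι Z : Type*} [Fintype ι] [MeasurableSpace Z]
    (Q : Measure Z) [IsProbabilityMeasure Q] {i j : ι} (hij : i ≠ j) {A : Set (Z × Z)}
    (hA : MeasurableSet A) (h0 : ∀ x, Q (Prod.mk x ⁻¹' A) = 0) :
    ∀ᵐ z ∂(Measure.pi fun _ : ι => Q), (z i, z j) ∉ A := by
  have hind : iIndepFun (fun (i : ι) (z : ι → Z) => z i) (Measure.pi fun _ : ι => Q) :=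
    iIndepFun_pi (X := fun (_ : ι) (x : Z) => x) fun _ => aemeasurable_id
  have hmap := (indepFun_iff_map_prod_eq_prod_map_map (measurable_pi_apply i).aemeasurable
    (measurable_pi_apply j).aemeasurable).1 (hind.indepFun hij)
  have he : ∀ i : ι, (Measure.pi fun _ : ι => Q).map (fun z => z i) = Q := fun i =>
    (measurePreserving_eval (fun _ : ι => Q) i).map_eq
  rw [he, he] at hmap
  have hAnull : (Q.prod Q) A = 0 := by
    rw [Measure.prod_apply hA]
    simp [h0]
  rw [← hmap, Measure.map_apply (by fun_prop) hA] at hAnull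
  exact measure_eq_zero_iff_ae_notMem.1 hAnull

theorem ae_injective_comp_of_null_fibers {n : ℕ} {Z : Type*} [MeasurableSpace Z] (Q : Measure Z)
    [IsProbabilityMeasure Q] {S : Z → ℝ} (hS : Measurable S) (h0 : ∀ s, Q {y | S y = s} = 0) :
    ∀ᵐ z ∂(Measure.pi fun _ : Fin n => Q), Function.Injective (S ∘ z) := by
  have h : ∀ i j : Fin n, ∀ᵐ z ∂(Measure.pi fun _ : Fin n => Q), i ≠ j → S (z i) ≠ S (z j) := by
    intro i j
    by_cases hij : i = j
    · exact ae_of_all _ fun z h => absurd hij h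
    · filter_upwards [ae_pair_notMem_of_null_sections Q hij (A := {x | S x.2 = S x.1})
        (measurableSet_eq_fun (by fun_prop) (by fun_prop)) fun x => h0 (S x)] with z hz _ h
      exact hz h.symm
  filter_upwards [ae_all_iff.2 fun i => ae_all_iff.2 fun j => h i j] with z hz i j hij
  by_contra hne
  exact hz i j hne hij

theorem volume_noise_fiber_eq_zero (a b r : ℝ) (hb : b ≠ 0) :
    (volume : Measure I) {u | a + b * (u : ℝ) = r} = 0 := by
  refine Set.Subsingleton.measure_zero (fun u hu v hv => ?_) _
  have hu : a + b * (u : ℝ) = r := hu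
  have hv : a + b * (v : ℝ) = r := hv
  exact Subtype.ext (mul_left_cancel₀ hb (by linarith))

/-- Label means are rational, so two bins can share a value only if their noise differs by a
rational over `δ`: countably many null conditions. -/
theorem ae_noise_sub_ne {L n : ℕ} (δ : ℝ) :
    ∀ᵐ V ∂(Measure.pi fun _ : Fin L => Measure.pi fun _ : Fin n => (volume : Measure I)),
      ∀ l b b', b ≠ b' → ∀ q : ℚ, (V l b : ℝ) - V l b' ≠ q / δ := by
  rw [ae_all_iff]
  intro l
  refine (measurePreserving_eval (fun _ : Fin L => Measure.pi fun _ : Fin n => (volume : Measure I))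
    l).quasiMeasurePreserving.ae (p := fun v => ∀ b b', b ≠ b' → ∀ q : ℚ,
      (v b : ℝ) - v b' ≠ q / δ) ?_
  simp only [ae_all_iff]
  intro b b' hne q
  refine (ae_pair_notMem_of_null_sections (volume : Measure I) hne
    (A := {x | (x.1 : ℝ) - x.2 = q / δ}) (measurableSet_eq_fun (by fun_prop) (by fun_prop))
    fun x => ?_)
  have := volume_noise_fiber_eq_zero x (-1) (q / δ) (by norm_num)
  simpa [neg_mul, ← sub_eq_add_neg] using this

section Calibration

variable {X : Type*} [MeasurableSpace X] {L n : ℕ} {g : X → Fin L → ℝ} {c : X → Fin L}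
  {δ : ℝ} {P : Measure (X × Fin L)}

theorem measurable_topClass (hc : Measurable c) : Measurable (topClass c) :=
  hc.comp (measurable_fst.comp measurable_fst)

theorem measurable_topScore (hg : Measurable g) (hc : Measurable c) :
    Measurable fun x => g x (c x) :=
  measurable_of_countable_cases (c := c) (F := fun l x => g x l)
    (fun l => hc (measurableSet_singleton l)) fun l => (measurable_pi_apply l).comp hg

theorem measurable_jitScore (hg : Measurable g) (hc : Measurable c) :
    Measurable (jitScore g c δ) :=
  measurable_jitter δ ((measurable_topScore hg hc).comp (measurable_fst.comp measurable_fst))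
    measurable_snd

theorem measurableSet_correctSet (hc : Measurable c) : MeasurableSet (correctSet c) :=
  measurableSet_eq_fun (measurable_snd.comp measurable_fst)
    (hc.comp (measurable_fst.comp measurable_fst))

theorem testLaw_jitScore_eq_zero (hg : Measurable g) (hc : Measurable c) (hδ : 0 < δ) (s : ℝ) :
    testLaw P {y | jitScore g c δ y = s} = 0 := by
  rw [testLaw, Measure.prod_apply
    (measurableSet_eq_fun (measurable_jitScore hg hc) measurable_const)]
  have : ∀ x : X × Fin L, (volume : Measure I) (Prod.mk x ⁻¹' {y | jitScore g c δ y = s}) = 0 := by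
    intro x
    have h := volume_noise_fiber_eq_zero (g x.1 (c x.1)) δ (s * (1 + δ)) hδ.ne'
    refine measure_mono_null (fun u hu => ?_) h
    have hu : (g x.1 (c x.1) + δ * (u : ℝ)) / (1 + δ) = s := hu
    exact (div_eq_iff (by linarith)).1 hu
  simp only [this, lintegral_zero]

theorem ae_jitScore_mem_Ico (hg : Measurable g) (hg_simplex : ∀ x, g x ∈ stdSimplex ℝ (Fin L))
    (hc : Measurable c) (hδ : 0 < δ) :
    ∀ᵐ y ∂(testLaw P), jitScore g c δ y ∈ Set.Ico (0 : ℝ) 1 := by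
  filter_upwards [measure_eq_zero_iff_ae_notMem.1 (testLaw_jitScore_eq_zero (P := P) hg hc hδ 1)]
    with y hy
  have h := jitter_mem_Icc hδ (mem_Icc_of_mem_stdSimplex (hg_simplex y.1.1) (c y.1.1)) y.2
  exact ⟨h.1, lt_of_le_of_ne h.2 hy⟩

variable [IsProbabilityMeasure P]

instance isProbabilityMeasure_testLaw : IsProbabilityMeasure (testLaw P) := by
  unfold testLaw
  infer_instance

instance isProbabilityMeasure_calibrationLaw : IsProbabilityMeasure (calibrationLaw P n) := by
  unfold calibrationLaw
  infer_instance

theorem measurePreserving_calibrationPoints :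
    MeasurePreserving (calibrationPoints (X := X) (L := L) (n := n)) (calibrationLaw P n)
      (Measure.pi fun _ => testLaw P) := by
  have h1 : MeasurePreserving
      (Prod.map id Prod.fst : CalibrationOutcome X L n → (Fin n → X × Fin L) × (Fin n → I))
      (calibrationLaw P n)
      ((Measure.pi fun _ => P).prod (Measure.pi fun _ => (volume : Measure I))) :=
    (MeasurePreserving.id _).prod measurePreserving_fst
  have h2 := (measurePreserving_arrowProdEquivProdArrow (X × Fin L) I (Fin n) (fun _ => P)
    (fun _ => (volume : Measure I))).symm
  exact h2.comp h1

theorem ae_outputNoise_sub_ne (δ : ℝ) :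
    ∀ᵐ ω ∂(calibrationLaw P n), ∀ l b b', b ≠ b' → ∀ q : ℚ,
      ((ω.2.2 l b : I) : ℝ) - ω.2.2 l b' ≠ q / δ := by
  have h : MeasurePreserving (fun ω : CalibrationOutcome X L n => ω.2.2) (calibrationLaw P n)
      (Measure.pi fun _ => Measure.pi fun _ => (volume : Measure I)) :=
    measurePreserving_snd.comp measurePreserving_snd
  exact h.quasiMeasurePreserving.ae (ae_noise_sub_ne δ)

theorem measurable_confidence (hg : Measurable g) (hc : Measurable c) (k : ℕ) (δ : ℝ)
    (ω : CalibrationOutcome X L n) :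
    Measurable (confidence (L := L) (topLabelHistogramBinning g c k δ ω)) := by
  refine measurable_of_countable_cases (c := topClass c) (F := fun l (y : (X × Fin L) × I) =>
    binaryHistogramBinning (fun x => g x (c x)) (classData c ω.1 l) (classCount c ω.1 l / k) δ
      (fun j => ω.2.1 (classPos c ω.1 l j))
      (fun b => ω.2.2 l (Fin.castLE (classCount_div_le c ω.1 l k) b)) (y.1.1, y.2))
    (fun l => measurable_topClass hc (measurableSet_singleton l)) fun l => ?_
  refine Finset.measurable_sum _ fun b _ => ?_
  exact (measurable_const.indicator measurableSet_Ico).comp (measurable_jitScore (δ := δ) hg hc)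

theorem ae_isBinnedPredictor (hg : Measurable g)
    (hg_simplex : ∀ x, g x ∈ stdSimplex ℝ (Fin L)) (hc : Measurable c) (hδ : 0 < δ) {k : ℕ}
    (hk0 : 0 < k) :
    ∀ᵐ ω ∂(calibrationLaw P n), (∀ l, k ≤ classCount c ω.1 l) →
      IsBinnedPredictor (testLaw P) (topClass c) (confidence (topLabelHistogramBinning g c k δ ω))
        (fun l => (classSet (topClass c) l (calibrationPoints ω)).card / k)
        (fun l b => classBin (topClass c) (jitScore g c δ) k l b (calibrationPoints ω))
        (binOutput g c k δ ω) := by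
  have hinj := measurePreserving_calibrationPoints.quasiMeasurePreserving.ae
    (ae_injective_comp_of_null_fibers (n := n) (testLaw P) (measurable_jitScore (δ := δ) hg hc)
      (testLaw_jitScore_eq_zero hg hc hδ))
  filter_upwards [hinj, ae_outputNoise_sub_ne δ] with ω hω hV hk
  refine ⟨measurable_topClass hc, measurable_confidence hg hc k δ ω,
    fun l b => measurableSet_classBin k (measurable_topClass hc) (measurable_jitScore hg hc) l b _,
    fun l b y hy => hy.1, fun l b b' y h h' => ?_, fun l b b' hb hb' h => ?_, ?_⟩
  · by_contra hne
    exact Set.disjoint_left.1 (classBin_disjoint (topClass c) (jitScore g c δ) k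
      (calibrationPoints ω) (fun h => hne (Prod.ext_iff.1 h).2 : (l, b) ≠ (l, b'))) h h'
  · by_contra hne
    have hbn : b < n := hb.trans_le (classCount_div_le c ω.1 l k)
    have hbn' : b' < n := hb'.trans_le (classCount_div_le c ω.1 l k)
    obtain ⟨q, hq⟩ := exists_hitMean_eq_ratCast (correctSet c) (classBinPoints (topClass c)
      (jitScore g c δ) k l b (calibrationPoints ω)) (calibrationPoints ω)
    obtain ⟨q', hq'⟩ := exists_hitMean_eq_ratCast (correctSet c) (classBinPoints (topClass c)
      (jitScore g c δ) k l b' (calibrationPoints ω)) (calibrationPoints ω)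
    refine hV l ⟨b, hbn⟩ ⟨b', hbn'⟩ (fun h => hne (Fin.mk.inj h)) (q' - q) ?_
    -- Equality of the two outputs reads `q + δ V_b = q' + δ V_b'`, that is `V_b - V_b' = (q' - q) /
    -- δ`.
    rw [binOutput, binOutput, hq, hq', jitter, jitter, div_left_inj' (by linarith), outputNoise,
      outputNoise, dif_pos hbn, dif_pos hbn'] at h
    rw [eq_div_iff hδ.ne']
    push_cast
    linarith
  · have hne : ∀ᵐ y ∂(testLaw P), ∀ i,
        jitScore g c δ (calibrationPoints ω i) ≠ jitScore g c δ y := by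
      rw [ae_all_iff]
      intro i
      filter_upwards [measure_eq_zero_iff_ae_notMem.1 (testLaw_jitScore_eq_zero (P := P) hg hc hδ
        (jitScore g c δ (calibrationPoints ω i)))] with y hy h
      exact hy h.symm
    filter_upwards [hne, ae_jitScore_mem_Ico hg hg_simplex hc hδ] with y hy hy'
    exact confidence_topLabelHistogramBinning g c δ ω hω y hy' hy hk0 (hk _)

end Calibration

/-! ### Calibration given the class counts -/

/-- Evaluates Hoeffding's bound at the chosen radius: `x = 2 / α` gives `α`, and `x = 2n / (kα)`
gives `kα / n`, which the `n / k` bins turn into `α`. The hypothesis `1 ≤ x` keeps the quantity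
under the root nonnegative. -/
theorem two_mul_exp_neg_sqrt_log_sq {k : ℕ} (hk : 2 ≤ k) {x : ℝ} (hx : 1 ≤ x) :
    2 * Real.exp (-(2 * ((k : ℝ) - 1) * √(Real.log x / (2 * ((k : ℝ) - 1))) ^ 2)) = 2 / x := by
  have hk' : (0 : ℝ) < 2 * ((k : ℝ) - 1) := by
    have : (2 : ℝ) ≤ k := by exact_mod_cast hk
    linarith
  rw [Real.sq_sqrt (div_nonneg (Real.log_nonneg hx) hk'.le), mul_div_cancel₀ _ hk'.ne',
    Real.exp_neg, Real.exp_log (by linarith), div_eq_mul_inv]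

theorem abs_sub_binOutput_le {X : Type*} {L n : ℕ} {g : X → Fin L → ℝ} {c : X → Fin L} {δ : ℝ}
    (hδ : 0 < δ) (k : ℕ) (ω : CalibrationOutcome X L n) (l : Fin L)
    (b : ℕ) (p : ℝ) :
    |p - binOutput g c k δ ω l b| ≤ |p - hitMean (correctSet c) (classBinPoints (topClass c)
      (jitScore g c δ) k l b (calibrationPoints ω)) (calibrationPoints ω)| + δ := by
  refine (abs_sub_le p _ _).trans (add_le_add le_rfl ?_)
  rw [abs_sub_comm]
  exact abs_jitter_sub_le hδ (hitMean_mem_Icc _ _ _) _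

theorem binOutput_mem_Icc {X : Type*} {L n : ℕ} {g : X → Fin L → ℝ} {c : X → Fin L} {δ : ℝ}
    (hδ : 0 < δ) (k : ℕ) (ω : CalibrationOutcome X L n) (l : Fin L)
    (b : ℕ) : binOutput g c k δ ω l b ∈ Set.Icc (0 : ℝ) 1 :=
  jitter_mem_Icc hδ (hitMean_mem_Icc _ _ _) _

/-- The class assignments with class counts in `T`. -/
def classAssignments {L : ℕ} (n : ℕ) (T : Set (Fin L → ℕ)) : Set (Fin n → Fin L) :=
  {a | (fun l => (Finset.univ.filter (a · = l)).card) ∈ T}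

theorem setOf_classCount_mem_eq_preimage {X : Type*} {L n : ℕ} {c : X → Fin L}
    {T : Set (Fin L → ℕ)} :
    {ω : CalibrationOutcome X L n | classCount c ω.1 ∈ T} =
      calibrationPoints ⁻¹' {z | (fun i => topClass c (z i)) ∈ classAssignments n T} := rfl

section Calibration

variable {X : Type*} [MeasurableSpace X] {L n : ℕ} {g : X → Fin L → ℝ} {c : X → Fin L}
  {δ : ℝ} {P : Measure (X × Fin L)} [IsProbabilityMeasure P] {T : Set (Fin L → ℕ)}

theorem measurableSet_topClasses_mem (hc : Measurable c) (A : Set (Fin n → Fin L)) :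
    MeasurableSet {z : Fin n → (X × Fin L) × I | (fun i => topClass c (z i)) ∈ A} := by
  have : Measurable fun z : Fin n → (X × Fin L) × I => fun i => topClass c (z i) :=
    measurable_pi_lambda _ fun i => (measurable_topClass hc).comp (measurable_pi_apply i)
  exact this (Set.to_countable A).measurableSet

theorem measurable_calibrationPoints :
    Measurable (calibrationPoints (X := X) (L := L) (n := n)) := by
  unfold calibrationPoints
  fun_prop

theorem measurableSet_classCount_mem (hc : Measurable c) :
    MeasurableSet {ω : CalibrationOutcome X L n | classCount c ω.1 ∈ T} := by
  rw [setOf_classCount_mem_eq_preimage]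
  exact measurable_calibrationPoints (measurableSet_topClasses_mem hc _)

/-- The loss depends on the calibration outcome only through the i.i.d. points, and the count event
is an event about their classes. The weights are bounded by `K` for every sample, so integrating
them produces `K` times the probability of the count event, which the normalisation cancels. -/
theorem lintegral_binLoss_cond_le (hg : Measurable g) (hc : Measurable c) (hδ : 0 < δ) {k : ℕ}
    (hk : 2 ≤ k) (hpos : calibrationLaw P n {ω | classCount c ω.1 ∈ T} ≠ 0)
    {wt : ENNReal → ENNReal} (hwt : Measurable wt) {ψ : ℝ → ℝ → ENNReal}
    (hψ : Measurable (Function.uncurry ψ)) {C K : ENNReal}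
    (hC : ∀ m, k - 1 ≤ m → CondLossBound (testLaw P) (correctSet c) ψ m C)
    (hK : ∀ z : Fin n → (X × Fin L) × I, binSum (topClass c) k z
      (fun l b => wt (testLaw P (classBin (topClass c) (jitScore g c δ) k l b z))) ≤ K) :
    ∫⁻ ω, binLoss (testLaw P) (topClass c) (jitScore g c δ) (correctSet c) k wt ψ
        (calibrationPoints ω) ∂((calibrationLaw P n)[|{ω | classCount c ω.1 ∈ T}]) ≤ C * K := by
  have hκ := measurable_topClass (L := L) hc
  have hS := measurable_jitScore (δ := δ) hg hc
  have ht := measurableSet_correctSet hc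
  have hmp := measurePreserving_calibrationPoints (P := P) (n := n)
  rw [ProbabilityTheory.cond, lintegral_smul_measure, smul_eq_mul,
    ENNReal.inv_mul_le_iff hpos (measure_ne_top _ _)]
  have hE := measurableSet_topClasses_mem (X := X) hc (classAssignments n T)
  rw [setOf_classCount_mem_eq_preimage, hmp.setLIntegral_comp_preimage hE
    (measurable_binLoss k (testLaw P) hκ hS ht hwt hψ), hmp.measure_preimage hE.nullMeasurableSet]
  refine (lintegral_binLoss_le k (testLaw P) hκ hS ht
    (ae_injective_comp_of_null_fibers (testLaw P) hS (testLaw_jitScore_eq_zero hg hc hδ)) hk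
    (classAssignments n T) hwt hψ hC).trans ?_
  calc _ ≤ C * ∫⁻ _ in {z : Fin n → (X × Fin L) × I |
        (fun i => topClass c (z i)) ∈ classAssignments n T}, K ∂(Measure.pi fun _ => testLaw P) := by
        gcongr with z
        exact hK z
    _ = _ := by rw [lintegral_const, Measure.restrict_apply_univ]; ring

theorem measurable_outputNoise (l : Fin L) (b : ℕ) :
    Measurable fun ω : CalibrationOutcome X L n => outputNoise ω l b := by
  unfold outputNoise
  split_ifs <;> fun_prop

theorem measurable_binOutput (hg : Measurable g) (hc : Measurable c) (k : ℕ) (l : Fin L) (b : ℕ) :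
    Measurable fun ω : CalibrationOutcome X L n => binOutput g c k δ ω l b :=
  measurable_jitter δ ((measurable_hitMean_classBinPoints k (measurable_topClass hc)
    (measurable_jitScore hg hc) (measurableSet_correctSet hc) l b).comp
      measurable_calibrationPoints) (measurable_outputNoise l b)

theorem measurable_indicator_dev (ε : ℝ) :
    Measurable (Function.uncurry fun a p : ℝ => if ε < |p - a| then (1 : ENNReal) else 0) :=
  Measurable.ite (measurableSet_lt measurable_const (by fun_prop)) measurable_const measurable_const

theorem measurable_abs_dev :
    Measurable (Function.uncurry fun a p : ℝ => ENNReal.ofReal |p - a|) := by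
  unfold Function.uncurry
  fun_prop

theorem binSum_measureReal_le {k : ℕ} (hg : Measurable g) (hc : Measurable c)
    (z : Fin n → (X × Fin L) × I) : binSum (topClass c) k z
      (fun l b => (testLaw P).real (classBin (topClass c) (jitScore g c δ) k l b z)) ≤ 1 := by
  have h := binSum_measure_le k (testLaw P) (measurable_topClass hc)
    (measurable_jitScore (δ := δ) hg hc) z
  have h' := ENNReal.toReal_mono ENNReal.one_ne_top h
  rw [binSum, ENNReal.toReal_sum fun l _ => (ENNReal.sum_lt_top.2 fun b _ =>
    measure_lt_top _ _).ne, ENNReal.toReal_one] at h'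
  refine le_trans (le_of_eq (Finset.sum_congr rfl fun l _ => ?_)) h'
  rw [ENNReal.toReal_sum fun b _ => measure_ne_top _ _]
  rfl

theorem ae_cond_isBinnedPredictor (hg : Measurable g)
    (hg_simplex : ∀ x, g x ∈ stdSimplex ℝ (Fin L)) (hc : Measurable c) (hδ : 0 < δ) {k : ℕ}
    (hk0 : 0 < k) (hT : ∀ m ∈ T, ∀ l, k ≤ m l) :
    ∀ᵐ ω ∂((calibrationLaw P n)[|{ω | classCount c ω.1 ∈ T}]),
      IsBinnedPredictor (testLaw P) (topClass c) (confidence (topLabelHistogramBinning g c k δ ω))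
        (fun l => (classSet (topClass c) l (calibrationPoints ω)).card / k)
        (fun l b => classBin (topClass c) (jitScore g c δ) k l b (calibrationPoints ω))
        (binOutput g c k δ ω) := by
  filter_upwards [cond_absolutelyContinuous.ae_le
    (ae_isBinnedPredictor (P := P) (n := n) hg hg_simplex hc hδ hk0),
    ae_cond_mem (measurableSet_classCount_mem hc)] with ω h hω
  exact h (hT _ hω)

theorem marginallyTopLabelCalibrated_of_log (hg : Measurable g)
    (hg_simplex : ∀ x, g x ∈ stdSimplex ℝ (Fin L)) (hc : Measurable c) (hδ : 0 < δ) {k : ℕ}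
    (hk : 2 ≤ k) (hT : ∀ m ∈ T, ∀ l, k ≤ m l)
    (hpos : calibrationLaw P n {ω | classCount c ω.1 ∈ T} ≠ 0) {α : ℝ}
    (hα : α ∈ Set.Ioo (0 : ℝ) 1) :
    MarginallyTopLabelCalibrated ((calibrationLaw P n)[|{ω | classCount c ω.1 ∈ T}]) P c
      (topLabelHistogramBinning g c k δ) (√(Real.log (2 / α) / (2 * ((k : ℝ) - 1))) + δ) α := by
  set ε := √(Real.log (2 / α) / (2 * ((k : ℝ) - 1)))
  set ν := (calibrationLaw P n)[|{ω | classCount c ω.1 ∈ T}]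
  have : IsProbabilityMeasure ν := cond_isProbabilityMeasure hpos
  set loss : CalibrationOutcome X L n → ENNReal := fun ω =>
    binLoss (testLaw P) (topClass c) (jitScore g c δ) (correctSet c) k id
      (fun a p => if ε < |p - a| then 1 else 0) (calibrationPoints ω)
  have hloss : ∫⁻ ω, loss ω ∂ν ≤ ENNReal.ofReal α := by
    refine (lintegral_binLoss_cond_le hg hc hδ hk hpos measurable_id (measurable_indicator_dev ε)
      (fun m hm => condLossBound_hoeffding (testLaw P) (measurableSet_correctSet hc)
        (Real.sqrt_nonneg _) hk hm) (K := 1) fun z => binSum_measure_le k (testLaw P)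
        (measurable_topClass hc) (measurable_jitScore hg hc) z).trans ?_
    rw [mul_one, two_mul_exp_neg_sqrt_log_sq hk
      ((le_div_iff₀ hα.1).2 (by linarith [hα.2]))]
    exact ENNReal.ofReal_le_ofReal (by rw [div_div_cancel₀ two_ne_zero])
  have hlm : Measurable loss := (measurable_binLoss k (testLaw P) (measurable_topClass hc)
    (measurable_jitScore hg hc) (measurableSet_correctSet hc) measurable_id
    (measurable_indicator_dev ε)).comp measurable_calibrationPoints
  calc ENNReal.ofReal (1 - α) = 1 - ENNReal.ofReal α := by
        rw [ENNReal.ofReal_sub _ hα.1.le, ENNReal.ofReal_one]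
    _ ≤ ∫⁻ _, 1 ∂ν - ∫⁻ ω, loss ω ∂ν := by
        rw [lintegral_one, measure_univ]
        exact tsub_le_tsub_left hloss 1
    -- Subtracting the measurable loss gives a lower bound for the coverage, whose own measurability
    -- in `ω` is then not needed.
    _ ≤ ∫⁻ ω, (1 - loss ω) ∂ν := lintegral_sub_le _ _ hlm
    _ ≤ _ := by
        refine lintegral_mono_ae ?_
        filter_upwards [ae_cond_isBinnedPredictor hg hg_simplex hc hδ (by omega) hT] with ω hω
        have h1 := hω.measure_abs_condExp_sub_gt_le (measurableSet_correctSet hc) (ε + δ)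
        have h2 : testLaw P {y | |condCorrect P c (topLabelHistogramBinning g c k δ ω) y -
            confidence (topLabelHistogramBinning g c k δ ω) y| ≤ ε + δ}ᶜ ≤ loss ω := by
          refine h1.trans (Finset.sum_le_sum fun l _ => Finset.sum_le_sum fun b _ => ?_)
          refine mul_le_mul' le_rfl ?_
          split_ifs with h
          · have := abs_sub_binOutput_le (g := g) (c := c) hδ k ω l b
              ((testLaw P)[|classBin (topClass c) (jitScore g c δ) k l b
                (calibrationPoints ω)].real (correctSet c))
            exact (if_pos (by linarith)).ge
          · exact zero_le
        rw [tsub_le_iff_right]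
        calc (1 : ENNReal) = testLaw P Set.univ := measure_univ.symm
          _ ≤ _ := by
            rw [← Set.union_compl_self {y | |condCorrect P c (topLabelHistogramBinning g c k δ ω) y -
              confidence (topLabelHistogramBinning g c k δ ω) y| ≤ ε + δ}]
            exact (measure_union_le _ _).trans (add_le_add le_rfl h2)

theorem conditionallyTopLabelCalibrated_of_log (hg : Measurable g)
    (hg_simplex : ∀ x, g x ∈ stdSimplex ℝ (Fin L)) (hc : Measurable c) (hδ : 0 < δ) {k : ℕ}
    (hk : 2 ≤ k) (hT : ∀ m ∈ T, ∀ l, k ≤ m l)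
    (hpos : calibrationLaw P n {ω | classCount c ω.1 ∈ T} ≠ 0) {α : ℝ}
    (hα : α ∈ Set.Ioo (0 : ℝ) 1) :
    ConditionallyTopLabelCalibrated ((calibrationLaw P n)[|{ω | classCount c ω.1 ∈ T}]) P c
      (topLabelHistogramBinning g c k δ)
      (√(Real.log (2 * (n : ℝ) / ((k : ℝ) * α)) / (2 * ((k : ℝ) - 1))) + δ) α := by
  set ε := √(Real.log (2 * (n : ℝ) / ((k : ℝ) * α)) / (2 * ((k : ℝ) - 1)))
  set ν := (calibrationLaw P n)[|{ω | classCount c ω.1 ∈ T}]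
  have hk0 : (0 : ℝ) < k := by exact_mod_cast (by omega : 0 < k)
  -- A nonempty sample space provides some class `l`, and an outcome with admissible counts gives `k
  -- ≤ n_l ≤ n`; this makes the argument of the logarithm at least `1`.
  have hkn : (k : ℝ) ≤ n := by
    obtain ⟨x, l⟩ : Nonempty (X × Fin L) := nonempty_of_isProbabilityMeasure P
    obtain ⟨ω, hω⟩ := nonempty_of_measure_ne_zero hpos
    exact_mod_cast (hT _ hω l).trans ((Finset.card_le_univ _).trans_eq (Fintype.card_fin n))
  set loss : CalibrationOutcome X L n → ENNReal := fun ω =>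
    binLoss (testLaw P) (topClass c) (jitScore g c δ) (correctSet c) k (fun _ => 1)
      (fun a p => if ε < |p - a| then 1 else 0) (calibrationPoints ω)
  have hloss : ∫⁻ ω, loss ω ∂ν ≤ ENNReal.ofReal α := by
    refine (lintegral_binLoss_cond_le hg hc hδ hk hpos measurable_const (measurable_indicator_dev ε)
      (fun m hm => condLossBound_hoeffding (testLaw P) (measurableSet_correctSet hc)
        (Real.sqrt_nonneg _) hk hm) fun z => binSum_one_le (topClass c) k z).trans ?_
    have hx : 1 ≤ 2 * (n : ℝ) / (k * α) := by
      rw [le_div_iff₀ (mul_pos hk0 hα.1)]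
      nlinarith [hα.1, hα.2]
    rw [two_mul_exp_neg_sqrt_log_sq hk hx, ← ENNReal.ofReal_mul (by positivity)]
    refine ENNReal.ofReal_le_ofReal (le_of_eq ?_)
    have hn : (n : ℝ) ≠ 0 := by linarith
    have := hα.1.ne'
    field_simp
  have hlm : Measurable loss := (measurable_binLoss k (testLaw P) (measurable_topClass hc)
    (measurable_jitScore hg hc) (measurableSet_correctSet hc) measurable_const
    (measurable_indicator_dev ε)).comp measurable_calibrationPoints
  -- With unit weights the loss is the number of bins with deviation above `ε`, so failure means
  -- that it is at least `1`, and Markov's inequality is the union bound.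
  have hmarkov : ν {ω | 1 ≤ loss ω} ≤ ∫⁻ ω, loss ω ∂ν := by
    simpa using mul_meas_ge_le_lintegral hlm 1
  refine (measure_mono_ae ?_).trans (hmarkov.trans hloss)
  filter_upwards [ae_cond_isBinnedPredictor hg hg_simplex hc hδ (by omega) hT] with ω hω hbad
  have hbad : ¬ ∀ (l : Fin L) (r : ℝ),
      testLaw P (levelSet c (topLabelHistogramBinning g c k δ ω) l r) ≠ 0 →
      |((testLaw P)[|levelSet c (topLabelHistogramBinning g c k δ ω) l r]).real (correctSet c) - r| ≤
        ε + δ := hbad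
  push Not at hbad
  obtain ⟨l, r, h0, hr⟩ := hbad
  obtain ⟨b, hb, rfl, hcond⟩ := hω.exists_of_level_ne_zero (t := correctSet c) h0
  have hr' : ε + δ < |(testLaw P)[|classBin (topClass c) (jitScore g c δ) k l b
      (calibrationPoints ω)].real (correctSet c) - binOutput g c k δ ω l b| := by
    rw [← hcond]
    exact hr
  have hdev := hr'.trans_le (abs_sub_binOutput_le hδ k ω l b _)
  have hterm : (1 : ENNReal) ≤ 1 * (if ε < |(testLaw P)[|classBin (topClass c) (jitScore g c δ) k l b
      (calibrationPoints ω)].real (correctSet c) - hitMean (correctSet c) (classBinPoints (topClass c)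
      (jitScore g c δ) k l b (calibrationPoints ω)) (calibrationPoints ω)| then 1 else 0) := by
    rw [if_pos (by linarith), one_mul]
  refine hterm.trans (le_trans ?_ (Finset.single_le_sum_of_canonicallyOrdered (Finset.mem_univ l)))
  exact Finset.single_le_sum_of_canonicallyOrdered
    (f := fun b => (1 : ENNReal) * (if ε < |(testLaw P)[|classBin (topClass c) (jitScore g c δ) k l b
      (calibrationPoints ω)].real (correctSet c) - hitMean (correctSet c) (classBinPoints (topClass c)
      (jitScore g c δ) k l b (calibrationPoints ω)) (calibrationPoints ω)| then 1 else 0))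
    (Finset.mem_range.2 hb)

theorem ae_tlECE_eq (hg : Measurable g)
    (hg_simplex : ∀ x, g x ∈ stdSimplex ℝ (Fin L)) (hc : Measurable c) (hδ : 0 < δ) {k : ℕ}
    (hk0 : 0 < k) (hT : ∀ m ∈ T, ∀ l, k ≤ m l) :
    ∀ᵐ ω ∂((calibrationLaw P n)[|{ω | classCount c ω.1 ∈ T}]),
      tlECE P c (topLabelHistogramBinning g c k δ ω) =
        binSum (topClass c) k (calibrationPoints ω) fun l b =>
          (testLaw P).real (classBin (topClass c) (jitScore g c δ) k l b (calibrationPoints ω)) *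
          |(testLaw P)[|classBin (topClass c) (jitScore g c δ) k l b (calibrationPoints ω)].real
            (correctSet c) - binOutput g c k δ ω l b| := by
  filter_upwards [ae_cond_isBinnedPredictor hg hg_simplex hc hδ hk0 hT] with ω hω
  exact hω.integral_abs_condExp_sub (measurableSet_correctSet hc)

theorem binSum_measureReal_mul_le {k : ℕ} (hg : Measurable g) (hc : Measurable c)
    (z : Fin n → (X × Fin L) × I) {f : Fin L → ℕ → ℝ} {M : ℝ} (hM : 0 ≤ M)
    (hf : ∀ l, ∀ b < (classSet (topClass c) l z).card / k,
      testLaw P (classBin (topClass c) (jitScore g c δ) k l b z) ≠ 0 → f l b ≤ M) :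
    binSum (topClass c) k z (fun l b =>
      (testLaw P).real (classBin (topClass c) (jitScore g c δ) k l b z) * f l b) ≤ M := by
  calc _ ≤ binSum (topClass c) k z (fun l b =>
        (testLaw P).real (classBin (topClass c) (jitScore g c δ) k l b z)) * M := by
        rw [binSum, binSum, Finset.sum_mul]
        refine Finset.sum_le_sum fun l _ => ?_
        rw [Finset.sum_mul]
        refine Finset.sum_le_sum fun b hb => ?_
        by_cases h0 : testLaw P (classBin (topClass c) (jitScore g c δ) k l b z) = 0
        · simp [Measure.real, h0]
        · exact mul_le_mul_of_nonneg_left (hf l b (Finset.mem_range.1 hb) h0) measureReal_nonneg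
    _ ≤ 1 * M := mul_le_mul_of_nonneg_right (binSum_measureReal_le hg hc z) hM
    _ = M := one_mul M

/-- The conditional expectation is chosen separately for each `ω`, so measurability is obtained from
the explicit bin sum, to which the error is almost surely equal; that sum is at most `1`. -/
theorem integrable_tlECE (hg : Measurable g)
    (hg_simplex : ∀ x, g x ∈ stdSimplex ℝ (Fin L)) (hc : Measurable c) (hδ : 0 < δ) {k : ℕ}
    (hk0 : 0 < k) (hT : ∀ m ∈ T, ∀ l, k ≤ m l)
    (hpos : calibrationLaw P n {ω | classCount c ω.1 ∈ T} ≠ 0) :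
    Integrable (fun ω => tlECE P c (topLabelHistogramBinning g c k δ ω))
      ((calibrationLaw P n)[|{ω | classCount c ω.1 ∈ T}]) := by
  have : IsProbabilityMeasure ((calibrationLaw P n)[|{ω | classCount c ω.1 ∈ T}]) :=
    cond_isProbabilityMeasure hpos
  have hκ := measurable_topClass (L := L) hc
  have hS := measurable_jitScore (δ := δ) hg hc
  have hae := ae_tlECE_eq (P := P) (n := n) hg hg_simplex hc hδ hk0 hT
  refine (integrable_congr hae).2 (Integrable.of_bound (C := 1) ?_ (ae_of_all _ fun ω => ?_))
  · refine (measurable_binSum k hκ measurable_calibrationPoints fun l b => ?_).aestronglyMeasurable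
    have h1 := ((measurable_measure_classBin k (testLaw P) hκ hS l b).comp
      (measurable_calibrationPoints (n := n))).ennreal_toReal
    have h2 := (measurable_cond_classBin k (testLaw P) hκ hS (measurableSet_correctSet hc) l b).comp
      (measurable_calibrationPoints (n := n))
    exact h1.mul (h2.sub (measurable_binOutput hg hc k l b)).abs
  · rw [Real.norm_eq_abs, binSum, abs_of_nonneg (Finset.sum_nonneg fun l _ => Finset.sum_nonneg fun b _ =>
      mul_nonneg measureReal_nonneg (abs_nonneg _))]
    refine binSum_measureReal_mul_le hg hc _ zero_le_one fun l b _ h0 => ?_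
    have : IsProbabilityMeasure ((testLaw P)[|classBin (topClass c) (jitScore g c δ) k l b
      (calibrationPoints ω)]) := cond_isProbabilityMeasure h0
    have h1 := binOutput_mem_Icc (g := g) (c := c) hδ k ω l b
    have h2 : (testLaw P)[|classBin (topClass c) (jitScore g c δ) k l b
      (calibrationPoints ω)].real (correctSet c) ≤ 1 := measureReal_le_one
    have h3 : 0 ≤ (testLaw P)[|classBin (topClass c) (jitScore g c δ) k l b
      (calibrationPoints ω)].real (correctSet c) := measureReal_nonneg
    exact abs_le.2 ⟨by linarith [h1.2], by linarith [h1.1]⟩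

/-- When all bins of positive mass have error at most `ε`, so does their average with weights of
total mass at most `1`. Null bins, about which calibration says nothing, do not contribute. -/
theorem one_sub_le_measure_tlECE_le (hg : Measurable g)
    (hg_simplex : ∀ x, g x ∈ stdSimplex ℝ (Fin L)) (hc : Measurable c) (hδ : 0 < δ) {k : ℕ}
    (hk0 : 0 < k) (hT : ∀ m ∈ T, ∀ l, k ≤ m l)
    (hpos : calibrationLaw P n {ω | classCount c ω.1 ∈ T} ≠ 0) {ε α : ℝ} (hε : 0 ≤ ε)
    (hα : 0 ≤ α) (hcal : ConditionallyTopLabelCalibrated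
      ((calibrationLaw P n)[|{ω | classCount c ω.1 ∈ T}]) P c
      (topLabelHistogramBinning g c k δ) ε α) :
    ENNReal.ofReal (1 - α) ≤ (calibrationLaw P n)[|{ω | classCount c ω.1 ∈ T}]
      {ω | tlECE P c (topLabelHistogramBinning g c k δ ω) ≤ ε} := by
  set ν := (calibrationLaw P n)[|{ω | classCount c ω.1 ∈ T}]
  have : IsProbabilityMeasure ν := cond_isProbabilityMeasure hpos
  have hsub : ν {ω | tlECE P c (topLabelHistogramBinning g c k δ ω) ≤ ε}ᶜ ≤ ENNReal.ofReal α := by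
    refine (measure_mono_ae ?_).trans hcal
    filter_upwards [ae_cond_isBinnedPredictor hg hg_simplex hc hδ hk0 hT,
      ae_tlECE_eq hg hg_simplex hc hδ hk0 hT] with ω hω heq hbad hgood
    refine hbad ?_
    change tlECE P c (topLabelHistogramBinning g c k δ ω) ≤ ε
    rw [heq]
    refine binSum_measureReal_mul_le hg hc _ hε fun l b hb h0 => ?_
    have h := hgood l (binOutput g c k δ ω l b)
      (by rw [← measure_congr (hω.level_ae_eq hb)] at h0; exact h0)
    rw [← hω.cond_level hb]
    exact h
  rw [ENNReal.ofReal_sub _ hα, ENNReal.ofReal_one, tsub_le_iff_right]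
  calc (1 : ENNReal) = ν Set.univ := measure_univ.symm
    _ ≤ _ := by
      rw [← Set.union_compl_self {ω | tlECE P c (topLabelHistogramBinning g c k δ ω) ≤ ε}]
      exact (measure_union_le _ _).trans (add_le_add le_rfl hsub)

/-- The error is the mass-weighted sum of bin errors. In each bin the output noise costs at most
`δ`, and what remains is the loss with absolute deviation, whose expectation is bounded through the
variance. -/
theorem integral_tlECE_le (hg : Measurable g)
    (hg_simplex : ∀ x, g x ∈ stdSimplex ℝ (Fin L)) (hc : Measurable c) (hδ : 0 < δ) {k : ℕ}
    (hk : 2 ≤ k) (hT : ∀ m ∈ T, ∀ l, k ≤ m l)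
    (hpos : calibrationLaw P n {ω | classCount c ω.1 ∈ T} ≠ 0) :
    ∫ ω, tlECE P c (topLabelHistogramBinning g c k δ ω)
      ∂((calibrationLaw P n)[|{ω | classCount c ω.1 ∈ T}]) ≤ √(1 / (2 * (k : ℝ))) + δ := by
  set ν := (calibrationLaw P n)[|{ω | classCount c ω.1 ∈ T}]
  have : IsProbabilityMeasure ν := cond_isProbabilityMeasure hpos
  set loss : CalibrationOutcome X L n → ENNReal := fun ω =>
    binLoss (testLaw P) (topClass c) (jitScore g c δ) (correctSet c) k id
      (fun a p => ENNReal.ofReal |p - a|) (calibrationPoints ω)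
  have hloss : ∫⁻ ω, loss ω ∂ν ≤ ENNReal.ofReal √(1 / (2 * (k : ℝ))) := by
    refine (lintegral_binLoss_cond_le hg hc hδ hk hpos measurable_id measurable_abs_dev
      (fun m hm => condLossBound_abs (testLaw P) (measurableSet_correctSet hc) hk hm) (K := 1)
      fun z => binSum_measure_le k (testLaw P) (measurable_topClass hc)
        (measurable_jitScore hg hc) z).trans_eq (mul_one _)
  rw [integral_eq_lintegral_of_nonneg_ae
    (f := fun ω => tlECE P c (topLabelHistogramBinning g c k δ ω))
    (ae_of_all _ fun ω => integral_nonneg fun y => abs_nonneg _)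
    (integrable_tlECE hg hg_simplex hc hδ (by omega) hT hpos).aestronglyMeasurable]
  refine ENNReal.toReal_le_of_le_ofReal (by positivity) ?_
  rw [ENNReal.ofReal_add (by positivity) hδ.le]
  calc _ ≤ ∫⁻ ω, (loss ω + ENNReal.ofReal δ) ∂ν := by
        refine lintegral_mono_ae ?_
        filter_upwards [ae_tlECE_eq hg hg_simplex hc hδ (by omega) hT] with ω hω
        rw [hω]
        set W := fun l b => classBin (topClass c) (jitScore g c δ) k l b (calibrationPoints ω)
        set e := fun l b => |(testLaw P)[|W l b].real (correctSet c) - hitMean (correctSet c)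
          (classBinPoints (topClass c) (jitScore g c δ) k l b (calibrationPoints ω))
          (calibrationPoints ω)|
        have hterm : ∀ l b, ENNReal.ofReal ((testLaw P).real (W l b) *
            |(testLaw P)[|W l b].real (correctSet c) - binOutput g c k δ ω l b|) ≤
            testLaw P (W l b) * ENNReal.ofReal (e l b) + testLaw P (W l b) * ENNReal.ofReal δ := by
          intro l b
          rw [ENNReal.ofReal_mul measureReal_nonneg, ofReal_measureReal, ← mul_add,
            ← ENNReal.ofReal_add (abs_nonneg _) hδ.le]
          gcongr
          exact abs_sub_binOutput_le hδ k ω l b _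
        have hsum : ENNReal.ofReal (binSum (topClass c) k (calibrationPoints ω) fun l b =>
            (testLaw P).real (W l b) *
              |(testLaw P)[|W l b].real (correctSet c) - binOutput g c k δ ω l b|) ≤
            loss ω + binSum (topClass c) k (calibrationPoints ω) (fun l b => testLaw P (W l b)) *
              ENNReal.ofReal δ := by
          simp only [loss, binLoss, binSum, id]
          rw [ENNReal.ofReal_sum_of_nonneg fun l _ => Finset.sum_nonneg fun b _ =>
            mul_nonneg measureReal_nonneg (abs_nonneg _), Finset.sum_mul, ← Finset.sum_add_distrib]
          refine Finset.sum_le_sum fun l _ => ?_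
          rw [ENNReal.ofReal_sum_of_nonneg fun b _ =>
            mul_nonneg measureReal_nonneg (abs_nonneg _), Finset.sum_mul, ← Finset.sum_add_distrib]
          exact Finset.sum_le_sum fun b _ => hterm l b
        refine hsum.trans (add_le_add le_rfl ?_)
        exact (mul_le_mul' (binSum_measure_le k (testLaw P) (measurable_topClass hc)
          (measurable_jitScore hg hc) _) le_rfl).trans_eq (one_mul _)
    _ = ∫⁻ ω, loss ω ∂ν + ENNReal.ofReal δ := by
        rw [lintegral_add_right _ measurable_const, lintegral_const, measure_univ, mul_one]
    _ ≤ _ := add_le_add hloss le_rfl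

end Calibration

theorem mainTheorem1 {X : Type*} [MeasurableSpace X] {L n k : ℕ} (hk : 2 ≤ k)
    (δ : ℝ) (hδ : 0 < δ)
    -- the base multiclass predictor, with values in the probability simplex
    (g : X → Fin L → ℝ) (hg : Measurable g) (hg_simplex : ∀ x, g x ∈ stdSimplex ℝ (Fin L))
    -- the top class of `g`, with ties broken in any measurable way
    (c : X → Fin L) (hc : Measurable c) (hc_top : ∀ x l, g x l ≤ g x (c x))
    (α : ℝ) (hα : α ∈ Set.Ioo (0 : ℝ) 1)
    (P : Measure (X × Fin L)) [IsProbabilityMeasure P]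
    -- the class counts `n_l` are known to lie in `T`, which forces `n_l ≥ k` for every `l`
    (T : Set (Fin L → ℕ)) (hT : ∀ m ∈ T, ∀ l, k ≤ m l)
    (hpos : calibrationLaw P n {ω | classCount c ω.1 ∈ T} ≠ 0) :
    let ν : Measure (CalibrationOutcome X L n) :=
      (calibrationLaw P n)[|{ω | classCount c ω.1 ∈ T}]
    let h : CalibrationOutcome X L n → X × unitInterval → ℝ :=
      topLabelHistogramBinning g c k δ
    let ε₁ : ℝ := √(Real.log (2 / α) / (2 * ((k : ℝ) - 1))) + δ
    let ε₂ : ℝ := √(Real.log (2 * (n : ℝ) / ((k : ℝ) * α)) / (2 * ((k : ℝ) - 1))) + δ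
    MarginallyTopLabelCalibrated ν P c h ε₁ α ∧
    ConditionallyTopLabelCalibrated ν P c h ε₂ α ∧
    ENNReal.ofReal (1 - α) ≤ ν {ω | tlECE P c (h ω) ≤ ε₂} ∧
    Integrable (fun ω => tlECE P c (h ω)) ν ∧
    ∫ ω, tlECE P c (h ω) ∂ν ≤ √(1 / (2 * (k : ℝ))) + δ := by
  have hcal := conditionallyTopLabelCalibrated_of_log (P := P) hg hg_simplex hc hδ hk hT hpos hα
  exact ⟨marginallyTopLabelCalibrated_of_log hg hg_simplex hc hδ hk hT hpos hα, hcal,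
    one_sub_le_measure_tlECE_le hg hg_simplex hc hδ (by omega) hT hpos (by positivity) hα.1.le hcal,
    integrable_tlECE hg hg_simplex hc hδ (by omega) hT hpos,
    integral_tlECE_le hg hg_simplex hc hδ hk hT hpos⟩
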